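/- Let $\mathbb{C}^+=\{w\in\mathbb{C}:\operatorname{Im} w>0\}$ and let $H^2$ be the Hardy space of all analytic functions $F$ on $\mathbb{C}^+$ with $\sup_{y>0}\int_{\mathbb{R}}|F(x+iy)|^2\,dx<\infty$, regarded as a subspace of $L^2(\mathbb{R})$ by identifying $F$ with its boundary function $f=\lim_{y\to0+}F(\cdot+iy)$ (limit in $L^2(\mathbb{R})$). For $\beta>1/2$ let $$B_\beta(w)=\prod_{n=1}^\infty \frac{\overline{z_n}}{z_n}\cdot\frac{w-z_n}{w-\overline{z_n}},\qquad z_n=n^\beta+i,\quad w\in\mathbb{C}^+,$$ be the Blaschke product with simple zeros at the points $z_n$, $n=1,2,3,\dots$, and let $K_{B_\beta}=H^2\ominus B_\beta H^2$ be the set of all $f\in H^2$ that are orthogonal in $L^2(\mathbb{R})$ to $B_\beta H^2$. **Theorem 3.1.** Let $\beta>2/3$. Then every nonzero $f\in K_{B_\beta}$ satisfies $$\int_0^\infty\frac{\log|f(t)|}{t^{3/2}+1}\,dt>-\infty ,$$ that is, $f(t)\neq0$ for almost every $t>0$ and the function $t\mapsto \log|f(t)|/(t^{3/2}+1)$ is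 Lebesgue integrable on $(0,\infty)$. (The positive part of the integrand is always integrable, because $f\in L^2(\mathbb{R})$.) -/

import Mathlib

open MeasureTheory Filter Topology Complex
open scoped ENNReal NNReal ComplexConjugate

noncomputable section

/-- `F` belongs to the Hardy class `H²` of the upper half-plane: it is analytic there, and its
`L²` norms on the horizontal lines `Im w = y`, `y > 0`, are uniformly bounded. (Values of `F`
outside the open upper half-plane play no role.) -/
def IsHardyTwo (F : ℂ → ℂ) : Prop :=
  DifferentiableOn ℂ F {w : ℂ | 0 < w.im} ∧
    ∃ C : ℝ≥0, ∀ y : ℝ, 0 < y → eLpNorm (fun x : ℝ => F (x + y * I)) 2 volume ≤ C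

/-- `f ∈ L²(ℝ)` is the boundary function on the real line of the function `F` on the upper
half-plane: `F(· + iy) → f` in `L²(ℝ)` as `y → 0+`. -/
def IsBoundaryFunction (F : ℂ → ℂ) (f : Lp ℂ 2 (volume : Measure ℝ)) : Prop :=
  Tendsto (fun y : ℝ => eLpNorm (fun x : ℝ => F (x + y * I) - f x) 2 volume) (𝓝[>] 0) (𝓝 0)

/-- The Hardy class `H²`, embedded in `L²(ℝ)` by boundary functions. -/
def hardySpace : Set (Lp ℂ 2 (volume : Measure ℝ)) :=
  {f | ∃ F : ℂ → ℂ, IsHardyTwo F ∧ IsBoundaryFunction F f}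

/-- The set `Θ H²`, embedded in `L²(ℝ)` by boundary functions. -/
def mulHardySpace (Θ : ℂ → ℂ) : Set (Lp ℂ 2 (volume : Measure ℝ)) :=
  {g | ∃ H : ℂ → ℂ, IsHardyTwo H ∧ IsBoundaryFunction (fun w => Θ w * H w) g}

/-- The model subspace `K_Θ = H² ⊖ Θ H²`: the elements of `H²` that are orthogonal in `L²(ℝ)`
to `Θ H²`. -/
def modelSpace (Θ : ℂ → ℂ) : Set (Lp ℂ 2 (volume : Measure ℝ)) :=
  {f | f ∈ hardySpace ∧ ∀ g ∈ mulHardySpace Θ, inner ℂ g f = 0}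

/-- The zeros `m ^ β + i`, `m = 1, 2, 3, …`, enumerated by `m = n + 1`. -/
def zeroBeta (β : ℝ) (n : ℕ) : ℂ := (((n + 1 : ℝ) ^ β : ℝ) : ℂ) + I

/-- The elementary Blaschke factor `e^{iα} (w - z) / (w - conj z)` with a zero `z` in the upper
half-plane; the unimodular constant `e^{iα}` is `conj z / z`, so that the value at `0` is `1`. -/
def blaschkeFactor (z w : ℂ) : ℂ := conj z / z * ((w - z) / (w - conj z))

/-- The Blaschke product with simple zeros at the points `m ^ β + i`, `m = 1, 2, 3, …`. -/
def blaschkeBeta (β : ℝ) (w : ℂ) : ℂ := ∏' n : ℕ, blaschkeFactor (zeroBeta β n) w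

/-- The product converges (unconditionally) in the upper half-plane when `β > 1/2`. -/
theorem multipliable_blaschkeBeta (β : ℝ) (hβ : 1 / 2 < β) (w : ℂ) (hw : 0 < w.im) :
    Multipliable fun n : ℕ => blaschkeFactor (zeroBeta β n) w := by
  have key : Summable fun n : ℕ => ‖blaschkeFactor (zeroBeta β n) w - 1‖ := by
    have hs : Summable fun n : ℕ => 2 * ‖w‖ * (1 + ‖w‖) * (1 / ((n + 1 : ℕ) : ℝ) ^ (2 * β)) := by
      apply Summable.mul_left
      exact (summable_nat_add_iff 1).2 (Real.summable_one_div_nat_rpow.2 (by linarith))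
    refine Summable.of_nonneg_of_le (fun _ => norm_nonneg _) (fun n => ?_) hs
    set r : ℝ := (n + 1 : ℝ) ^ β with hr
    have hr0 : 0 < r := by positivity
    have hz : zeroBeta β n = (r : ℂ) + I := rfl
    set z := zeroBeta β n with hzd
    have hzre : z.re = r := by simp [hz]
    have hzim : z.im = 1 := by simp [hz]
    have hz1 : r ≤ ‖z‖ := by
      have := Complex.abs_re_le_norm z
      rw [hzre] at this
      exact (le_abs_self r).trans this
    have hz0 : z ≠ 0 := by
      intro h; rw [h] at hz1; simp at hz1; linarith
    have hd1 : 1 ≤ ‖w - conj z‖ := by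
      have := Complex.abs_im_le_norm (w - conj z)
      have h2 : (w - conj z).im = w.im + 1 := by simp [hzim]
      rw [h2] at this
      have := (le_abs_self (w.im + 1)).trans this
      linarith
    have hd0 : w - conj z ≠ 0 := by
      intro h; rw [h] at hd1; simp at hd1; linarith
    have hle : ‖z‖ ≤ (1 + ‖w‖) * ‖w - conj z‖ := by
      have h1 : ‖z‖ = ‖w - (w - conj z)‖ := by simp
      have h2 := norm_sub_le w (w - conj z)
      have h3 := norm_nonneg w
      nlinarith
    have hid : blaschkeFactor z w - 1 = -(2 * I * w) / (z * (w - conj z)) := by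
      have hc : conj z = z - 2 * I := by
        apply Complex.ext <;> simp [hzim]; norm_num
      unfold blaschkeFactor
      rw [eq_div_iff (mul_ne_zero hz0 hd0)]
      field_simp
      rw [hc]
      ring
    have hr2 : ((n + 1 : ℕ) : ℝ) ^ (2 * β) = r * r := by
      rw [hr, ← Real.rpow_add (by positivity)]; push_cast; ring_nf
    rw [hid, hr2, norm_div, norm_mul, norm_neg, norm_mul, norm_mul]
    simp only [Complex.norm_ofNat, Complex.norm_I, mul_one]
    rw [mul_one_div, div_le_div_iff₀ (by positivity) (by positivity)]
    have h4 : r * r ≤ ‖z‖ * ((1 + ‖w‖) * ‖w - conj z‖) := by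
      calc r * r ≤ ‖z‖ * ‖z‖ := by gcongr
        _ ≤ _ := by gcongr
    have h5 : 0 ≤ 2 * ‖w‖ := by positivity
    nlinarith [mul_le_mul_of_nonneg_left h4 h5]
  simpa using multipliable_one_add_of_summable key

end

/-!
# Logarithmic integrability on the half-line for the model space of `B_β`

The harmonic measure of the plane slit along `[0, ∞)` has a density that decays like `t ^ (-3/2)`,
and the proof works in that slit plane, uniformized by `w = ζ ^ 2` with `ζ` in the upper half-plane.

An element `f` of the model space extends analytically across the real line, with poles at the
points `conj z_n = n ^ β - i` only. In the variable `ζ` these poles form a Blaschke sequence of the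
upper half-plane precisely when `∑ n ^ (-3β/2) < ∞`, that is, `β > 2/3`; let `E` be the Blaschke
product over them (`reflectedRootProduct`). The function `G(ζ) = E(ζ) f(ζ ^ 2)` (`slitExtension`) is
then analytic in the upper half-plane. The key identity is that `A(ζ) = E(ζ) B(ζ ^ 2)`
(`rootProduct`) is again a Blaschke product, over the reflections of the poles in the imaginary
axis. Hence `G` is given by a single absolutely convergent integral,

  `G(ζ) = (2πi)⁻¹ ∫ f(t) (E(ζ) - A(ζ) conj B(t)) / (t - ζ ^ 2) dt`.

For `ζ` in the first quadrant, the first half of this integral is `E(ζ) f(ζ ^ 2)` by the Cauchy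
formula for Hardy functions (`IsHardyTwo.integral_mul_inv_sub`), and the second half vanishes since
`f` is orthogonal to `B(t) / (t - conj w)` (`integral_mul_conj_blaschkeBeta_eq_zero`). A modulus of
continuity of `B` on the closed upper half-plane bounds the kernel
(`exists_norm_slitKernel_le`), so that `G` is continuous up to the real line and of polynomial
growth, and `|G(√t)| = |f(t)|` for almost every `t > 0` (`norm_slitExtension_sqrt`).

After division by a power of `ζ + i` the function `G` is bounded. Jensen's formula in the disc and
Fatou's lemma show that its logarithm is integrable on the boundary against the Poisson kernel
(`lintegral_negLog_sqrt_ne_top`), whose density in the variable `t` is `1 / (√t (1 + t))`, and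
this density dominates `1 / (t ^ (3/2) + 1)`.
-/

noncomputable section

/-! ### Blaschke products on the closed upper half-plane -/

/-- A Blaschke sequence of the upper half-plane that accumulates only at infinity. -/
structure IsBlaschkeSeq (a : ℕ → ℂ) : Prop where
  im_pos : ∀ n, 0 < (a n).im
  summable : Summable fun n => (a n).im / ‖a n‖ ^ 2
  tendsto_norm : Tendsto (fun n => ‖a n‖) atTop atTop

/-- The Blaschke product with zeros `a n`, normalized to be `1` at the origin. -/
def blaschkeProduct (a : ℕ → ℂ) (w : ℂ) : ℂ := ∏' n, blaschkeFactor (a n) w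

theorem sub_conj_ne_zero_of_im {z w : ℂ} (hz : 0 < z.im) (hw : 0 ≤ w.im) : w - conj z ≠ 0 := by
  intro h
  have := congrArg Complex.im h
  simp at this
  linarith

theorem ne_zero_of_im_pos {z : ℂ} (hz : 0 < z.im) : z ≠ 0 := by
  rintro rfl; simp at hz

theorem norm_conj_div_self {z : ℂ} (hz : z ≠ 0) : ‖conj z / z‖ = 1 := by
  rw [norm_div, Complex.norm_conj, div_self (norm_ne_zero_iff.2 hz)]

theorem norm_sub_le_norm_sub_conj {z w : ℂ} (hz : 0 < z.im) (hw : 0 ≤ w.im) :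
    ‖w - z‖ ≤ ‖w - conj z‖ := by
  rw [Complex.norm_def, Complex.norm_def]
  apply Real.sqrt_le_sqrt
  simp only [Complex.normSq_apply, Complex.sub_re, Complex.sub_im, Complex.conj_re, Complex.conj_im]
  nlinarith [mul_nonneg hz.le hw]

theorem norm_blaschkeFactor_le_one {z w : ℂ} (hz : 0 < z.im) (hw : 0 ≤ w.im) :
    ‖blaschkeFactor z w‖ ≤ 1 := by
  rw [blaschkeFactor, norm_mul, norm_conj_div_self (ne_zero_of_im_pos hz), one_mul, norm_div]
  exact div_le_one_of_le₀ (norm_sub_le_norm_sub_conj hz hw) (norm_nonneg _)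

theorem norm_blaschkeFactor_ofReal {z : ℂ} (hz : 0 < z.im) (x : ℝ) :
    ‖blaschkeFactor z x‖ = 1 := by
  have h : ‖(x : ℂ) - conj z‖ = ‖(x : ℂ) - z‖ := by
    rw [← Complex.norm_conj ((x : ℂ) - z)]; simp
  have h0 : (x : ℂ) - conj z ≠ 0 := sub_conj_ne_zero_of_im hz (by simp)
  rw [blaschkeFactor, norm_mul, norm_conj_div_self (ne_zero_of_im_pos hz), one_mul, norm_div, ← h,
    div_self (norm_ne_zero_iff.2 h0)]

theorem blaschkeFactor_sub_one {z w : ℂ} (hz : 0 < z.im) (hw : 0 ≤ w.im) :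
    blaschkeFactor z w - 1 = -(2 * z.im * I * w) / (z * (w - conj z)) := by
  have hz0 := ne_zero_of_im_pos hz
  have hd := sub_conj_ne_zero_of_im hz hw
  have hc : conj z = z - 2 * z.im * I := by
    apply Complex.ext <;> simp; ring
  rw [blaschkeFactor, eq_div_iff (mul_ne_zero hz0 hd)]
  field_simp
  rw [hc]
  ring

theorem norm_blaschkeFactor_sub_one_le {z w : ℂ} {R : ℝ} (hz : 0 < z.im) (hw : 0 ≤ w.im)
    (hwR : ‖w‖ ≤ R) (hzR : 2 * R ≤ ‖z‖) :
    ‖blaschkeFactor z w - 1‖ ≤ 4 * R * (z.im / ‖z‖ ^ 2) := by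
  have hz0 : 0 < ‖z‖ := norm_pos_iff.2 (ne_zero_of_im_pos hz)
  have hR : 0 ≤ R := (norm_nonneg w).trans hwR
  have h1 : ‖z‖ / 2 ≤ ‖w - conj z‖ := by
    have := norm_sub_norm_le (conj z) w
    rw [Complex.norm_conj, norm_sub_rev] at this
    linarith
  rw [blaschkeFactor_sub_one hz hw, norm_div, norm_neg, norm_mul, norm_mul, norm_mul, norm_mul]
  simp only [Complex.norm_ofNat, Complex.norm_I, mul_one, Complex.norm_real, Real.norm_eq_abs,
    abs_of_pos hz]
  calc 2 * z.im * ‖w‖ / (‖z‖ * ‖w - conj z‖) ≤ 2 * z.im * R / (‖z‖ * (‖z‖ / 2)) := by gcongr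
    _ = 4 * R * (z.im / ‖z‖ ^ 2) := by field_simp; ring

theorem continuousOn_blaschkeFactor {z : ℂ} (hz : 0 < z.im) :
    ContinuousOn (blaschkeFactor z) {w | 0 ≤ w.im} := by
  unfold blaschkeFactor
  refine continuousOn_const.mul (ContinuousOn.div (by fun_prop) (by fun_prop) ?_)
  exact fun w hw => sub_conj_ne_zero_of_im hz hw

theorem isOpen_upperHalfPlane : IsOpen {w : ℂ | 0 < w.im} :=
  isOpen_lt continuous_const Complex.continuous_im

theorem isClosed_closedUpperHalfPlane : IsClosed {w : ℂ | 0 ≤ w.im} :=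
  isClosed_le continuous_const Complex.continuous_im

namespace IsBlaschkeSeq

variable {a : ℕ → ℂ}

theorem hasProdUniformlyOn (ha : IsBlaschkeSeq a) {K : Set ℂ} (hK : IsCompact K)
    (hK' : K ⊆ {w | 0 ≤ w.im}) :
    HasProdUniformlyOn (fun n w => blaschkeFactor (a n) w) (blaschkeProduct a) K := by
  obtain ⟨R, hR⟩ := hK.isBounded.exists_norm_le
  have := Summable.hasProdUniformlyOn_nat_one_add (f := fun n w => blaschkeFactor (a n) w - 1) hK
    (ha.summable.mul_left (4 * R)) (by
      filter_upwards [ha.tendsto_norm.eventually_ge_atTop (2 * R)] with n hn w hw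
      exact norm_blaschkeFactor_sub_one_le (ha.im_pos n) (hK' hw) (hR w hw) hn)
    (fun n => ((continuousOn_blaschkeFactor (ha.im_pos n)).mono hK').sub continuousOn_const)
  simp only [add_sub_cancel] at this
  exact this

theorem hasProd (ha : IsBlaschkeSeq a) {w : ℂ} (hw : 0 ≤ w.im) :
    HasProd (fun n => blaschkeFactor (a n) w) (blaschkeProduct a w) :=
  (ha.hasProdUniformlyOn (isCompact_singleton (x := w)) (by simpa using hw)).hasProd
    (Set.mem_singleton w)

theorem continuousOn_blaschkeProduct (ha : IsBlaschkeSeq a) :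
    ContinuousOn (blaschkeProduct a) {w | 0 ≤ w.im} := by
  intro w hw
  have hK : IsCompact (Metric.closedBall w 1 ∩ {w : ℂ | 0 ≤ w.im}) :=
    (isCompact_closedBall w 1).inter_right isClosed_closedUpperHalfPlane
  have hc : ContinuousOn (blaschkeProduct a) (Metric.closedBall w 1 ∩ {w : ℂ | 0 ≤ w.im}) := by
    refine (hasProdUniformlyOn_iff_tendstoUniformlyOn.1
      (ha.hasProdUniformlyOn hK Set.inter_subset_right)).continuousOn (Frequently.of_forall ?_)
    intro s
    refine continuousOn_finsetProd _ fun n _ => ?_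
    exact (continuousOn_blaschkeFactor (ha.im_pos n)).mono Set.inter_subset_right
  refine (hc w ⟨Metric.mem_closedBall_self zero_le_one, hw⟩).mono_of_mem_nhdsWithin ?_
  exact inter_mem (mem_nhdsWithin_of_mem_nhds (Metric.closedBall_mem_nhds w one_pos))
    self_mem_nhdsWithin

theorem differentiableOn_blaschkeProduct (ha : IsBlaschkeSeq a) :
    DifferentiableOn ℂ (blaschkeProduct a) {w | 0 < w.im} := by
  have h : HasProdLocallyUniformlyOn (fun n w => blaschkeFactor (a n) w) (blaschkeProduct a)
      {w | 0 < w.im} :=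
    hasProdLocallyUniformlyOn_of_forall_compact isOpen_upperHalfPlane fun K hK hc =>
      ha.hasProdUniformlyOn hc (hK.trans fun w (hw : 0 < w.im) => hw.le)
  refine h.differentiableOn (Eventually.of_forall fun s => ?_) isOpen_upperHalfPlane
  refine DifferentiableOn.fun_finsetProd fun n _ w hw => ?_
  have := sub_conj_ne_zero_of_im (ha.im_pos n) (le_of_lt hw)
  unfold blaschkeFactor
  fun_prop (disch := assumption)

theorem norm_blaschkeProduct_le_one (ha : IsBlaschkeSeq a) {w : ℂ} (hw : 0 ≤ w.im) :
    ‖blaschkeProduct a w‖ ≤ 1 := by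
  refine le_of_tendsto (ha.hasProd hw).norm (Eventually.of_forall fun s => ?_)
  exact Finset.prod_le_one (fun _ _ => norm_nonneg _) fun n _ =>
    norm_blaschkeFactor_le_one (ha.im_pos n) hw

theorem norm_blaschkeProduct_ofReal (ha : IsBlaschkeSeq a) (x : ℝ) :
    ‖blaschkeProduct a x‖ = 1 := by
  refine tendsto_nhds_unique (ha.hasProd (w := x) (by simp)).norm ?_
  refine tendsto_const_nhds.congr fun s => ?_
  exact (Finset.prod_eq_one fun n _ => norm_blaschkeFactor_ofReal (ha.im_pos n) x).symm

end IsBlaschkeSeq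

theorem norm_prod_sub_prod_le {ι : Type*} (s : Finset ι) (u v : ι → ℂ) (hu : ∀ i, ‖u i‖ ≤ 1)
    (hv : ∀ i, ‖v i‖ ≤ 1) : ‖∏ i ∈ s, u i - ∏ i ∈ s, v i‖ ≤ ∑ i ∈ s, ‖u i - v i‖ := by
  classical
  induction s using Finset.induction_on with
  | empty => simp
  | insert i s hi ih =>
    rw [Finset.prod_insert hi, Finset.prod_insert hi, Finset.sum_insert hi]
    have h1 : ‖∏ i ∈ s, u i‖ ≤ 1 := by
      rw [norm_prod]; exact Finset.prod_le_one (fun _ _ => norm_nonneg _) fun n _ => hu n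
    calc ‖u i * ∏ i ∈ s, u i - v i * ∏ i ∈ s, v i‖
        = ‖(u i - v i) * ∏ i ∈ s, u i + v i * (∏ i ∈ s, u i - ∏ i ∈ s, v i)‖ := by ring_nf
      _ ≤ ‖u i - v i‖ * ‖∏ i ∈ s, u i‖ + ‖v i‖ * ‖∏ i ∈ s, u i - ∏ i ∈ s, v i‖ := by
        rw [← norm_mul, ← norm_mul]; exact norm_add_le _ _
      _ ≤ ‖u i - v i‖ * 1 + 1 * ∑ i ∈ s, ‖u i - v i‖ := by
        gcongr; exact hv i
      _ = _ := by ring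

/-! ### The zeros `m ^ β + i` and their square roots -/

theorem zeroBeta_im (β : ℝ) (n : ℕ) : (zeroBeta β n).im = 1 := by simp [zeroBeta]

theorem zeroBeta_re (β : ℝ) (n : ℕ) : (zeroBeta β n).re = (n + 1 : ℝ) ^ β := by simp [zeroBeta]

theorem rpow_le_norm_zeroBeta (β : ℝ) (n : ℕ) : (n + 1 : ℝ) ^ β ≤ ‖zeroBeta β n‖ :=
  zeroBeta_re β n ▸ (le_abs_self _).trans (Complex.abs_re_le_norm _)

theorem tendsto_natCast_add_one_rpow {β : ℝ} (hβ : 0 < β) :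
    Tendsto (fun n : ℕ => (n + 1 : ℝ) ^ β) atTop atTop :=
  (tendsto_rpow_atTop hβ).comp
    (tendsto_atTop_add_const_right _ _ tendsto_natCast_atTop_atTop)

theorem summable_inv_norm_zeroBeta_sq {β : ℝ} (hβ : 1 / 2 < β) :
    Summable fun n => 1 / ‖zeroBeta β n‖ ^ 2 := by
  have hs : Summable fun n : ℕ => 1 / ((n + 1 : ℕ) : ℝ) ^ (2 * β) :=
    (summable_nat_add_iff 1).2 (Real.summable_one_div_nat_rpow.2 (by linarith))
  refine Summable.of_nonneg_of_le (fun _ => by positivity) (fun n => ?_) hs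
  have hr2 : ((n + 1 : ℕ) : ℝ) ^ (2 * β) = ((n + 1 : ℝ) ^ β) ^ 2 := by
    rw [sq, ← Real.rpow_add (by positivity)]; push_cast; ring_nf
  rw [hr2]
  have := rpow_le_norm_zeroBeta β n
  gcongr

theorem isBlaschkeSeq_zeroBeta {β : ℝ} (hβ : 1 / 2 < β) : IsBlaschkeSeq (zeroBeta β) where
  im_pos n := by simp [zeroBeta_im]
  summable := by simpa [zeroBeta_im] using summable_inv_norm_zeroBeta_sq hβ
  tendsto_norm := tendsto_atTop_mono (rpow_le_norm_zeroBeta β)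
    (tendsto_natCast_add_one_rpow (by linarith))

theorem norm_le_mul_norm_sub_conj {z w : ℂ} (hz : z.im = 1) (hw : 0 ≤ w.im) :
    ‖z‖ ≤ (1 + ‖w‖) * ‖w - conj z‖ := by
  have hd1 : 1 ≤ ‖w - conj z‖ := by
    have h1 := (le_abs_self _).trans (Complex.abs_im_le_norm (w - conj z))
    simp only [Complex.sub_im, Complex.conj_im, hz] at h1
    linarith
  have h1 : ‖z‖ = ‖w - (w - conj z)‖ := by simp
  have h2 := norm_sub_le w (w - conj z)
  nlinarith [norm_nonneg w]

theorem norm_blaschkeFactor_sub_le {z t w : ℂ} (hz : z.im = 1) (ht : 0 ≤ t.im) (hw : 0 ≤ w.im) :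
    ‖blaschkeFactor z t - blaschkeFactor z w‖ ≤
      2 * ‖t - w‖ * (1 + ‖w‖) * (1 + ‖t‖) * (1 / ‖z‖ ^ 2) := by
  have hz' : 0 < z.im := by rw [hz]; exact one_pos
  have hz0 : 0 < ‖z‖ := norm_pos_iff.2 (ne_zero_of_im_pos hz')
  have hdt := sub_conj_ne_zero_of_im hz' ht
  have hdw := sub_conj_ne_zero_of_im hz' hw
  have hc : z = conj z + 2 * I := by
    apply Complex.ext <;> simp [hz]; norm_num
  have hid : blaschkeFactor z t - blaschkeFactor z w =
      conj z / z * (2 * I * (t - w) / ((t - conj z) * (w - conj z))) := by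
    rw [blaschkeFactor, blaschkeFactor, ← mul_sub]
    congr 1
    field_simp
    generalize conj z = c at *
    subst hc
    ring
  rw [hid, norm_mul, norm_conj_div_self (ne_zero_of_im_pos hz'), one_mul, norm_div, norm_mul,
    norm_mul, norm_mul]
  simp only [Complex.norm_ofNat, Complex.norm_I, mul_one]
  have h1 := norm_le_mul_norm_sub_conj hz ht
  have h2 := norm_le_mul_norm_sub_conj hz hw
  have h3 : 0 < ‖t - conj z‖ := norm_pos_iff.2 hdt
  have h4 : 0 < ‖w - conj z‖ := norm_pos_iff.2 hdw
  rw [mul_one_div, div_le_div_iff₀ (by positivity) (by positivity)]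
  calc 2 * ‖t - w‖ * ‖z‖ ^ 2
      ≤ 2 * ‖t - w‖ * (((1 + ‖t‖) * ‖t - conj z‖) * ((1 + ‖w‖) * ‖w - conj z‖)) := by
        rw [sq]; gcongr
    _ = _ := by ring

/-- A quantitative modulus of continuity of `B` on the closed upper half-plane, obtained by
telescoping the difference of the partial products. -/
theorem exists_norm_blaschkeBeta_sub_le {β : ℝ} (hβ : 1 / 2 < β) :
    ∃ C : ℝ, 0 ≤ C ∧ ∀ t w : ℂ, 0 ≤ t.im → 0 ≤ w.im →
      ‖blaschkeBeta β t - blaschkeBeta β w‖ ≤ C * ‖t - w‖ * (1 + ‖w‖) * (1 + ‖t‖) := by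
  have ha := isBlaschkeSeq_zeroBeta hβ
  have hs := summable_inv_norm_zeroBeta_sq hβ
  refine ⟨2 * ∑' n, 1 / ‖zeroBeta β n‖ ^ 2, ?_, fun t w ht hw => ?_⟩
  · have : 0 ≤ ∑' n, 1 / ‖zeroBeta β n‖ ^ 2 := tsum_nonneg fun n => by positivity
    linarith
  refine le_of_tendsto ((ha.hasProd ht).sub (ha.hasProd hw)).norm (Eventually.of_forall fun s => ?_)
  calc _ ≤ ∑ n ∈ s, ‖blaschkeFactor (zeroBeta β n) t - blaschkeFactor (zeroBeta β n) w‖ :=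
        norm_prod_sub_prod_le s _ _ (fun n => norm_blaschkeFactor_le_one (ha.im_pos n) ht)
          (fun n => norm_blaschkeFactor_le_one (ha.im_pos n) hw)
    _ ≤ ∑ n ∈ s, 2 * ‖t - w‖ * (1 + ‖w‖) * (1 + ‖t‖) * (1 / ‖zeroBeta β n‖ ^ 2) :=
        Finset.sum_le_sum fun n _ => norm_blaschkeFactor_sub_le (zeroBeta_im β n) ht hw
    _ = 2 * ‖t - w‖ * (1 + ‖w‖) * (1 + ‖t‖) * ∑ n ∈ s, 1 / ‖zeroBeta β n‖ ^ 2 := by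
        rw [Finset.mul_sum]
    _ ≤ 2 * ‖t - w‖ * (1 + ‖w‖) * (1 + ‖t‖) * ∑' n, 1 / ‖zeroBeta β n‖ ^ 2 := by
        gcongr; exact hs.sum_le_tsum s fun n _ => by positivity
    _ = _ := by ring

/-- Every point of the upper half-plane has a square root in the open first quadrant. -/
theorem exists_sq_eq_of_im_pos {z : ℂ} (hz : 0 < z.im) :
    ∃ a : ℂ, a ^ 2 = z ∧ 0 < a.re ∧ 0 < a.im := by
  obtain ⟨b, hb⟩ := IsAlgClosed.exists_pow_nat_eq z (n := 2) two_pos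
  have h : 2 * (b.re * b.im) = z.im := by rw [← hb, sq, Complex.mul_im]; ring
  have hpos : 0 < b.re * b.im := by linarith
  rcases pos_and_pos_or_neg_and_neg_of_mul_pos hpos with ⟨h1, h2⟩ | ⟨h1, h2⟩
  · exact ⟨b, hb, h1, h2⟩
  · exact ⟨-b, by rw [neg_sq, hb], by simpa using h1, by simpa using h2⟩

/-- The square root of `m ^ β + i` in the first quadrant. -/
def sqrtZero (β : ℝ) (n : ℕ) : ℂ :=
  (exists_sq_eq_of_im_pos (z := zeroBeta β n) (by simp [zeroBeta_im])).choose

theorem sqrtZero_spec (β : ℝ) (n : ℕ) :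
    sqrtZero β n ^ 2 = zeroBeta β n ∧ 0 < (sqrtZero β n).re ∧ 0 < (sqrtZero β n).im :=
  (exists_sq_eq_of_im_pos (z := zeroBeta β n) (by simp [zeroBeta_im])).choose_spec

theorem norm_sqrtZero_sq (β : ℝ) (n : ℕ) : ‖sqrtZero β n‖ ^ 2 = ‖zeroBeta β n‖ := by
  rw [← norm_pow, (sqrtZero_spec β n).1]

/-- With `a ^ 2 = m ^ β + i` one has `2 Re a Im a = 1` and `Re a ≥ m ^ (β / 2)`, so the Blaschke
condition for the square roots is the convergence of `∑ m ^ (-3 β / 2)`. -/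
theorem sqrtZero_im_div_le (β : ℝ) (n : ℕ) :
    (sqrtZero β n).im / ‖sqrtZero β n‖ ^ 2 ≤ 1 / ((n + 1 : ℕ) : ℝ) ^ (3 / 2 * β) := by
  obtain ⟨h1, h2, h3⟩ := sqrtZero_spec β n
  set a := sqrtZero β n
  have him : 2 * (a.re * a.im) = 1 := by
    have := congrArg Complex.im h1
    rw [sq, Complex.mul_im, zeroBeta_im] at this
    linarith
  have hre : (n + 1 : ℝ) ^ β ≤ a.re ^ 2 := by
    have := congrArg Complex.re h1
    rw [sq, Complex.mul_re, zeroBeta_re] at this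
    nlinarith
  have hn : (0 : ℝ) < n + 1 := by positivity
  have hsq : ((n + 1 : ℝ) ^ (β / 2)) ^ 2 = (n + 1 : ℝ) ^ β := by
    rw [← Real.rpow_natCast, ← Real.rpow_mul hn.le]; congr 1; push_cast; ring
  have hre' : (n + 1 : ℝ) ^ (β / 2) ≤ a.re :=
    abs_le_of_sq_le_sq' (hsq ▸ hre) h2.le |>.2
  have hn2 : 0 < (n + 1 : ℝ) ^ (β / 2) := by positivity
  have hn1 : 0 < (n + 1 : ℝ) ^ β := by positivity
  have him' : a.im ≤ 1 / (n + 1 : ℝ) ^ (β / 2) := by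
    rw [le_div_iff₀ hn2]
    nlinarith
  have hnorm : (n + 1 : ℝ) ^ β ≤ ‖a‖ ^ 2 := norm_sqrtZero_sq β n ▸ rpow_le_norm_zeroBeta β n
  calc a.im / ‖a‖ ^ 2 ≤ (1 / (n + 1 : ℝ) ^ (β / 2)) / (n + 1 : ℝ) ^ β := by gcongr
    _ = 1 / ((n + 1 : ℕ) : ℝ) ^ (3 / 2 * β) := by
      rw [div_div, ← Real.rpow_add hn]; push_cast; congr 2; ring

theorem isBlaschkeSeq_sqrtZero {β : ℝ} (hβ : 2 / 3 < β) : IsBlaschkeSeq (sqrtZero β) where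
  im_pos n := (sqrtZero_spec β n).2.2
  summable := by
    have hs : Summable fun n : ℕ => 1 / ((n + 1 : ℕ) : ℝ) ^ (3 / 2 * β) :=
      (summable_nat_add_iff 1).2 (Real.summable_one_div_nat_rpow.2 (by linarith))
    exact Summable.of_nonneg_of_le
      (fun n => div_nonneg (sqrtZero_spec β n).2.2.le (by positivity)) (sqrtZero_im_div_le β) hs
  tendsto_norm := by
    have h := (isBlaschkeSeq_zeroBeta (β := β) (by linarith)).tendsto_norm
    refine (Real.tendsto_sqrt_atTop.comp h).congr fun n => ?_
    simp only [Function.comp_apply, ← norm_sqrtZero_sq, Real.sqrt_sq (norm_nonneg _)]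

theorem IsBlaschkeSeq.neg_conj {a : ℕ → ℂ} (ha : IsBlaschkeSeq a) :
    IsBlaschkeSeq fun n => -conj (a n) where
  im_pos n := by simpa using ha.im_pos n
  summable := by simpa using ha.summable
  tendsto_norm := by simpa using ha.tendsto_norm

/-- The Blaschke product with zeros at the first-quadrant square roots of `m ^ β + i`. -/
def rootProduct (β : ℝ) : ℂ → ℂ := blaschkeProduct (sqrtZero β)

/-- The Blaschke product with zeros at the second-quadrant square roots of `m ^ β - i`. -/
def reflectedRootProduct (β : ℝ) : ℂ → ℂ := blaschkeProduct fun n => -conj (sqrtZero β n)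

/-- On the first quadrant the poles of `B (ζ ^ 2)` are absent, and multiplication by `B (ζ ^ 2)`
turns the product over the second-quadrant roots into the one over the first-quadrant roots. -/
theorem rootProduct_eq {β : ℝ} (hβ : 2 / 3 < β) {ζ : ℂ} (hre : 0 ≤ ζ.re) (him : 0 ≤ ζ.im) :
    rootProduct β ζ = reflectedRootProduct β ζ * blaschkeBeta β (ζ ^ 2) := by
  have ha := isBlaschkeSeq_sqrtZero hβ
  have hw : 0 ≤ (ζ ^ 2).im := by rw [sq, Complex.mul_im]; nlinarith [mul_nonneg hre him]
  have h1 := (ha.neg_conj.hasProd him).mul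
    ((isBlaschkeSeq_zeroBeta (by linarith : 1 / 2 < β)).hasProd hw)
  refine (ha.hasProd him).unique ?_
  convert! h1 using 2 with n
  obtain ⟨h2, h3, h4⟩ := sqrtZero_spec β n
  rw [← h2]
  set a := sqrtZero β n
  have ha0 : a ≠ 0 := ne_zero_of_im_pos h4
  have hca0 : conj a ≠ 0 := by simpa using ha0
  have e1 : ζ - conj a ≠ 0 := sub_conj_ne_zero_of_im h4 him
  have e2 : ζ + a ≠ 0 := fun h => by
    have := congrArg Complex.im h; simp at this; linarith
  have e3 : ζ + conj a ≠ 0 := fun h => by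
    have := congrArg Complex.re h; simp at this; linarith
  have e4 : ζ ^ 2 - conj a ^ 2 ≠ 0 := by
    rw [sq_sub_sq]; exact mul_ne_zero e3 e1
  simp only [blaschkeFactor, map_neg, map_pow, Complex.conj_conj, sub_neg_eq_add]
  rw [sq_sub_sq, sq_sub_sq]
  field_simp

/-- The counterpart of `rootProduct_eq` on the second quadrant, where `B (ζ ^ 2)` is replaced by
`1 / conj (B (conj (ζ ^ 2)))`. -/
theorem reflectedRootProduct_eq {β : ℝ} (hβ : 2 / 3 < β) {ζ : ℂ} (hre : ζ.re ≤ 0)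
    (him : 0 ≤ ζ.im) :
    reflectedRootProduct β ζ = rootProduct β ζ * conj (blaschkeBeta β (conj ζ ^ 2)) := by
  have h := rootProduct_eq hβ (ζ := -conj ζ) (by simpa using hre) (by simpa using him)
  have hA : ∀ {a : ℕ → ℂ}, IsBlaschkeSeq a →
      blaschkeProduct a (-conj ζ) = conj (blaschkeProduct (fun n => -conj (a n)) ζ) := by
    intro a ha
    refine (ha.hasProd (w := -conj ζ) (by simpa using him)).unique ?_
    convert! (ha.neg_conj.hasProd him).map (starRingEnd ℂ) Complex.continuous_conj using 2 with n
    simp only [blaschkeFactor, Function.comp_apply, map_neg, map_mul, map_div₀, map_sub,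
      Complex.conj_conj, neg_div_neg_eq]
    congr 1
    rw [← neg_div_neg_eq]
    congr 1 <;> ring
  have ha := isBlaschkeSeq_sqrtZero hβ
  rw [rootProduct, reflectedRootProduct, hA ha, hA ha.neg_conj] at h
  simp only [map_neg, Complex.conj_conj, neg_neg, neg_sq] at h
  have h' := congrArg conj h
  simpa [rootProduct, reflectedRootProduct] using h'

/-! ### Integrability of `log |G|` on the boundary of a half-plane -/

/-- The function `- log a` with values in `[0, ∞]`, equal to `∞` at `a = 0` (and to `0` for
`a ≥ 1`). -/
def negLog (a : ℝ) : ℝ≥0∞ := if a = 0 then ⊤ else ENNReal.ofReal (-Real.log a)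

theorem continuous_negLog : Continuous negLog := by
  rw [continuous_iff_continuousAt]
  intro a
  by_cases ha : a = 0
  · subst ha
    rw [ContinuousAt, show negLog 0 = ⊤ by simp [negLog], ENNReal.tendsto_nhds_top_iff_nnreal]
    intro M
    have h : Tendsto Real.log (𝓝[≠] 0) atBot := Real.tendsto_log_nhdsNE_zero
    have h2 := h.eventually_lt_atBot (-(M : ℝ))
    rw [eventually_nhdsWithin_iff] at h2
    filter_upwards [h2] with x hx
    by_cases hx0 : x = 0
    · simp [negLog, hx0]
    · rw [negLog, if_neg hx0, ← ENNReal.ofReal_coe_nnreal]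
      have := hx hx0
      exact (ENNReal.ofReal_lt_ofReal_iff (by linarith [M.coe_nonneg])).2 (by linarith)
  · have : ContinuousAt (fun x => ENNReal.ofReal (-Real.log x)) a :=
      ENNReal.continuous_ofReal.continuousAt.comp (Real.continuousAt_log ha).neg
    refine this.congr ?_
    filter_upwards [isOpen_ne.mem_nhds ha] with x hx
    rw [negLog, if_neg hx]

/-- Jensen's formula bounds the integrals of `- log |h|` over concentric circles, uniformly in the
radius, for a function `h` that is bounded by `1`. -/
theorem exists_lintegral_negLog_circleMap_le {h : ℂ → ℂ}
    (hd : DifferentiableOn ℂ h (Metric.ball 0 1)) (hb : ∀ s ∈ Metric.ball (0 : ℂ) 1, ‖h s‖ ≤ 1)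
    (hne : ∃ s ∈ Metric.ball (0 : ℂ) 1, h s ≠ 0) :
    ∃ C : ℝ, ∀ r : ℝ, 1 / 2 ≤ r → r < 1 →
      ∫⁻ θ in Set.Ioc 0 (2 * Real.pi), negLog ‖h (circleMap 0 r θ)‖ ≤ ENNReal.ofReal C := by
  have han : AnalyticOnNhd ℂ h (Metric.ball 0 1) := hd.analyticOnNhd Metric.isOpen_ball
  set k : ℤ := (meromorphicOrderAt h 0).untop₀ with hk
  set T : ℝ := Real.log ‖meromorphicTrailingCoeffAt h 0‖ with hT
  refine ⟨2 * Real.pi * -(k * Real.log (1 / 2) + T), fun r hr1 hr2 => ?_⟩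
  have hr0 : 0 < r := by linarith
  have habs : |r| = r := abs_of_pos hr0
  have hsub : Metric.closedBall (0 : ℂ) |r| ⊆ Metric.ball 0 1 := by
    rw [habs]; exact Metric.closedBall_subset_ball hr2
  have hanr : AnalyticOnNhd ℂ h (Metric.closedBall 0 |r|) := han.mono hsub
  have hk0 : 0 ≤ k := by
    have h1 := MeromorphicOn.AnalyticOnNhd.divisor_nonneg hanr 0
    rwa [MeromorphicOn.divisor_apply hanr.meromorphicOn (by simp)] at h1
  have hmem : ∀ θ, circleMap 0 r θ ∈ Metric.ball (0 : ℂ) 1 := fun θ =>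
    hsub (habs.symm ▸ circleMap_mem_closedBall 0 hr0.le θ)
  have hjensen : k * Real.log (1 / 2) + T ≤ Real.circleAverage (fun z => Real.log ‖h z‖) 0 r := by
    rw [hanr.meromorphicOn.circleAverage_log_norm hr0.ne',
      MeromorphicOn.divisor_apply hanr.meromorphicOn (by simp), ← hk, ← hT]
    have h1 : 0 ≤ ∑ᶠ u, (MeromorphicOn.divisor h (Metric.closedBall 0 |r|) u : ℝ) *
        Real.log (r * ‖(0 : ℂ) - u‖⁻¹) := by
      refine finsum_nonneg fun u => ?_
      by_cases hu : u ∈ Metric.closedBall (0 : ℂ) |r|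
      · refine mul_nonneg (mod_cast MeromorphicOn.AnalyticOnNhd.divisor_nonneg hanr u) ?_
        rw [mem_closedBall_zero_iff, habs] at hu
        rw [zero_sub, norm_neg]
        rcases (norm_nonneg u).eq_or_lt with h0 | h0
        · simp [← h0]
        · apply Real.log_nonneg
          rw [← div_eq_mul_inv, one_le_div h0]
          exact hu
      · simp [Function.locallyFinsuppWithin.apply_eq_zero_of_notMem _ hu]
    have h2 : (k : ℝ) * Real.log (1 / 2) ≤ k * Real.log r := by
      have : (0 : ℝ) ≤ k := mod_cast hk0
      gcongr
    linarith
  have hint : CircleIntegrable (fun z => Real.log ‖h z‖) 0 r :=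
    (hanr.mono Metric.sphere_subset_closedBall).meromorphicOn.circleIntegrable_log_norm
  have hae : ∀ᵐ θ ∂(volume.restrict (Set.Ioc 0 (2 * Real.pi))), h (circleMap 0 r θ) ≠ 0 := by
    obtain ⟨s, hs, hs0⟩ := hne
    have h1 := han.preimage_zero_mem_codiscreteWithin hs0 hs
      ⟨⟨0, by simp⟩, (convex_ball (0 : ℂ) 1).isPreconnected⟩
    have h2 := circleMap_preimage_codiscrete hr0.ne'
      (codiscreteWithin_mono (Metric.sphere_subset_closedBall.trans hsub) h1)
    exact ae_restrict_le_codiscreteWithin measurableSet_Ioc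
      (codiscreteWithin_mono (Set.subset_univ _) h2)
  have hpi : (0 : ℝ) ≤ 2 * Real.pi := by positivity
  have hI : IntegrableOn (fun θ => -Real.log ‖h (circleMap 0 r θ)‖) (Set.Ioc 0 (2 * Real.pi)) :=
    ((intervalIntegrable_iff_integrableOn_Ioc_of_le hpi).1 hint).neg
  have hnn : ∀ θ, 0 ≤ -Real.log ‖h (circleMap 0 r θ)‖ := fun θ =>
    neg_nonneg.2 (Real.log_nonpos (norm_nonneg _) (hb _ (hmem θ)))
  calc ∫⁻ θ in Set.Ioc 0 (2 * Real.pi), negLog ‖h (circleMap 0 r θ)‖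
      = ∫⁻ θ in Set.Ioc 0 (2 * Real.pi), ENNReal.ofReal (-Real.log ‖h (circleMap 0 r θ)‖) := by
        refine lintegral_congr_ae ?_
        filter_upwards [hae] with θ hθ
        rw [negLog, if_neg (norm_ne_zero_iff.2 hθ)]
    _ = ENNReal.ofReal (∫ θ in Set.Ioc 0 (2 * Real.pi), -Real.log ‖h (circleMap 0 r θ)‖) :=
        (ofReal_integral_eq_lintegral_ofReal hI (Eventually.of_forall hnn)).symm
    _ ≤ _ := by
        apply ENNReal.ofReal_le_ofReal
        rw [integral_neg, ← intervalIntegral.integral_of_le hpi]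
        rw [Real.circleAverage, smul_eq_mul, ← div_eq_inv_mul, le_div_iff₀ (by positivity)]
          at hjensen
        linarith

/-- The boundary values of a bounded analytic function `h ≠ 0` in the disc have integrable
logarithm, provided `h` is continuous up to the boundary except at one point. -/
theorem lintegral_negLog_circle_ne_top {h : ℂ → ℂ}
    (hd : DifferentiableOn ℂ h (Metric.ball 0 1))
    (hc : ContinuousOn h (Metric.closedBall 0 1 \ {1}))
    (hb : ∀ s ∈ Metric.ball (0 : ℂ) 1, ‖h s‖ ≤ 1)
    (hne : ∃ s ∈ Metric.ball (0 : ℂ) 1, h s ≠ 0) :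
    ∫⁻ θ in Set.Ioc 0 (2 * Real.pi), negLog ‖h (circleMap 0 1 θ)‖ ≠ ⊤ := by
  obtain ⟨C, hC⟩ := exists_lintegral_negLog_circleMap_le hd hb hne
  set r : ℕ → ℝ := fun n => 1 - 1 / (n + 2) with hr
  have hr1 : ∀ n, 1 / 2 ≤ r n := fun n => by
    have : 1 / ((n : ℝ) + 2) ≤ 1 / 2 := by gcongr; linarith [Nat.cast_nonneg (α := ℝ) n]
    simp only [hr]; linarith
  have hr2 : ∀ n, r n < 1 := fun n => by
    have : 0 < 1 / ((n : ℝ) + 2) := by positivity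
    simp only [hr]; linarith
  have hrt : Tendsto r atTop (𝓝 1) := by
    have h1 : Tendsto (fun n : ℕ => 1 / ((n : ℝ) + 2)) atTop (𝓝 0) :=
      tendsto_const_nhds.div_atTop
        (tendsto_atTop_add_const_right _ _ tendsto_natCast_atTop_atTop)
    simpa [hr] using h1.const_sub 1
  have hmeas : ∀ n, Measurable fun θ => negLog ‖h (circleMap 0 (r n) θ)‖ := fun n => by
    refine (continuous_negLog.comp (continuous_norm.comp ?_)).measurable
    refine hd.continuousOn.comp_continuous (continuous_circleMap 0 (r n)) fun θ => ?_
    exact Metric.closedBall_subset_ball (hr2 n)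
      (circleMap_mem_closedBall 0 (by linarith [hr1 n]) θ)
  have hlim : ∀ θ ∈ Set.Ioo 0 (2 * Real.pi), Tendsto
      (fun n => negLog ‖h (circleMap 0 (r n) θ)‖) atTop (𝓝 (negLog ‖h (circleMap 0 1 θ)‖)) := by
    intro θ hθ
    have h1 : circleMap 0 1 θ ≠ 1 := fun h => by
      rw [circleMap, zero_add, Complex.ofReal_one, one_mul, Complex.exp_eq_one_iff] at h
      obtain ⟨n, hn⟩ := h
      have h2 : θ = n * (2 * Real.pi) := by
        have := congrArg Complex.im hn
        simpa using this
      have hpi := Real.pi_pos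
      rw [h2] at hθ
      have h3 : (0 : ℝ) < n := by nlinarith [hθ.1]
      have h4 : (n : ℝ) < 1 := by nlinarith [hθ.2]
      have h5 : 0 < n := by exact_mod_cast h3
      have h6 : n < 1 := by exact_mod_cast h4
      omega
    have h2 : Tendsto (fun n => circleMap 0 (r n) θ) atTop
        (𝓝[Metric.closedBall 0 1 \ {1}] (circleMap 0 1 θ)) := by
      refine tendsto_nhdsWithin_iff.2 ⟨?_, Eventually.of_forall fun n => ?_⟩
      · have : Tendsto (fun n => (0 : ℂ) + (r n : ℂ) * exp (θ * I)) atTop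
            (𝓝 (0 + ((1 : ℝ) : ℂ) * exp (θ * I))) :=
          (((Complex.continuous_ofReal.tendsto 1).comp hrt).mul_const _).const_add _
        simpa only [circleMap] using this
      · have h3 := circleMap_mem_closedBall (0 : ℂ) (by linarith [hr1 n] : 0 ≤ r n) θ
        refine ⟨Metric.closedBall_subset_closedBall (hr2 n).le h3, fun h4 => ?_⟩
        rw [Set.mem_singleton_iff.1 h4, mem_closedBall_zero_iff, norm_one] at h3
        linarith [hr2 n]
    have h5 : circleMap 0 1 θ ∈ Metric.closedBall (0 : ℂ) 1 \ {1} :=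
      ⟨circleMap_mem_closedBall 0 zero_le_one θ, h1⟩
    exact (continuous_negLog.tendsto _).comp ((hc _ h5).tendsto.comp h2).norm
  refine ne_top_of_le_ne_top (ENNReal.ofReal_ne_top (r := C)) ?_
  calc ∫⁻ θ in Set.Ioc 0 (2 * Real.pi), negLog ‖h (circleMap 0 1 θ)‖
      = ∫⁻ θ in Set.Ioo 0 (2 * Real.pi),
          liminf (fun n => negLog ‖h (circleMap 0 (r n) θ)‖) atTop := by
        rw [restrict_Ioo_eq_restrict_Ioc.symm]
        exact setLIntegral_congr_fun measurableSet_Ioo fun θ hθ => (hlim θ hθ).liminf_eq.symm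
    _ ≤ liminf (fun n => ∫⁻ θ in Set.Ioo 0 (2 * Real.pi), negLog ‖h (circleMap 0 (r n) θ)‖)
          atTop := lintegral_liminf_le hmeas
    _ ≤ liminf (fun _ : ℕ => ENNReal.ofReal C) atTop := by
        refine liminf_le_liminf (Eventually.of_forall fun n => ?_)
        rw [restrict_Ioo_eq_restrict_Ioc]
        exact hC (r n) (hr1 n) (hr2 n)
    _ = ENNReal.ofReal C := by simp

/-- The Cayley transform from the disc to the upper half-plane. -/
def cayleyInv (s : ℂ) : ℂ := I * (1 + s) / (1 - s)

theorem cayleyInv_im (s : ℂ) : (cayleyInv s).im = (1 - ‖s‖ ^ 2) / normSq (1 - s) := by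
  rw [cayleyInv, Complex.div_im, ← sub_div, Complex.sq_norm]
  simp [Complex.normSq_apply]
  ring

theorem circleMap_two_arctan (u : ℝ) :
    circleMap 0 1 (2 * Real.arctan u + Real.pi) = -((1 + u * I) / (1 - u * I)) := by
  have h1 : exp (Real.arctan u * I) = (1 + u * I) / Real.sqrt (1 + u ^ 2) := by
    rw [Complex.exp_mul_I, ← Complex.ofReal_cos, ← Complex.ofReal_sin, Real.cos_arctan,
      Real.sin_arctan]
    push_cast
    ring
  rw [Complex.ofReal_arctan] at h1
  have h2 : ((Real.sqrt (1 + u ^ 2) : ℝ) : ℂ) ^ 2 = (1 + u * I) * (1 - u * I) := by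
    rw [← Complex.ofReal_pow, Real.sq_sqrt (by positivity)]
    push_cast
    linear_combination (u : ℂ) ^ 2 * I_sq
  have h3 : (1 : ℂ) + u * I ≠ 0 := fun h => by simpa using congrArg Complex.re h
  rw [circleMap, zero_add]
  push_cast
  rw [one_mul, add_mul, Complex.exp_add, Complex.exp_pi_mul_I, mul_assoc, two_mul (_ * I),
    Complex.exp_add, h1, ← sq, div_pow, h2, sq, mul_div_mul_left _ _ h3]
  ring

theorem cayleyInv_circleMap (u : ℝ) :
    cayleyInv (circleMap 0 1 (2 * Real.arctan u + Real.pi)) = u := by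
  have h3 : (1 : ℂ) - u * I ≠ 0 := fun h => by simpa using congrArg Complex.re h
  have e1 : 1 + -((1 + u * I) / (1 - u * I)) = -(2 * u * I) / (1 - u * I) := by
    rw [eq_div_iff h3, add_mul, neg_mul, div_mul_cancel₀ _ h3]; ring
  have e2 : 1 - -((1 + u * I) / (1 - u * I)) = 2 / (1 - u * I) := by
    rw [eq_div_iff h3, sub_mul, neg_mul, div_mul_cancel₀ _ h3]; ring
  rw [circleMap_two_arctan, cayleyInv, e1, e2, ← mul_div_assoc, div_div_div_cancel_right₀ h3]
  linear_combination (-(u : ℂ)) * I_sq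

/-- The boundary values `G (√t)`, `t > 0`, of a bounded analytic function in the upper half-plane
that is continuous up to the real line: in the variable `t` the Poisson weight becomes
`1 / (√t (1 + t))`. -/
theorem lintegral_negLog_sqrt_ne_top {G : ℂ → ℂ} (hd : DifferentiableOn ℂ G {w | 0 < w.im})
    (hc : ContinuousOn G {w | 0 ≤ w.im}) (hb : ∀ w : ℂ, 0 < w.im → ‖G w‖ ≤ 1)
    (hne : ∃ w : ℂ, 0 < w.im ∧ G w ≠ 0) :
    ∫⁻ t in Set.Ioi (0 : ℝ), ENNReal.ofReal (1 / (Real.sqrt t * (1 + t))) *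
      negLog ‖G (Real.sqrt t)‖ ≠ ⊤ := by
  have hs1 : ∀ s ∈ Metric.closedBall (0 : ℂ) 1 \ {1}, 1 - s ≠ 0 := fun s hs h0 =>
    hs.2 (sub_eq_zero.1 h0).symm
  have hs2 : ∀ s ∈ Metric.ball (0 : ℂ) 1, 1 - s ≠ 0 := fun s hs h0 => by
    rw [← sub_eq_zero.1 h0] at hs; simp at hs
  have him : ∀ s ∈ Metric.ball (0 : ℂ) 1, 0 < (cayleyInv s).im := fun s hs => by
    rw [cayleyInv_im]
    rw [mem_ball_zero_iff] at hs
    exact div_pos (by nlinarith [norm_nonneg s]) (Complex.normSq_pos.2 (hs2 s (by simpa using hs)))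
  have him' : ∀ s ∈ Metric.closedBall (0 : ℂ) 1, 0 ≤ (cayleyInv s).im := fun s hs => by
    rw [cayleyInv_im]
    rw [mem_closedBall_zero_iff] at hs
    exact div_nonneg (by nlinarith [norm_nonneg s]) (Complex.normSq_nonneg _)
  have key := lintegral_negLog_circle_ne_top (h := G ∘ cayleyInv)
    (hd.comp (t := {w | 0 < w.im}) (fun s hs => by
        have := hs2 s hs
        unfold cayleyInv
        fun_prop (disch := assumption)) him)
    (hc.comp (t := {w | 0 ≤ w.im}) (fun s hs => by
        have := hs1 s hs
        unfold cayleyInv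
        fun_prop (disch := assumption)) fun s hs => him' s hs.1)
    (fun s hs => hb _ (him s hs)) (by
      obtain ⟨w, hw, hw0⟩ := hne
      have h1 : w + I ≠ 0 := fun h => by
        have := congrArg Complex.im h; simp at this; linarith
      refine ⟨(w - I) / (w + I), ?_, ?_⟩
      · rw [mem_ball_zero_iff, norm_div, div_lt_one (norm_pos_iff.2 h1), Complex.norm_def,
          Complex.norm_def]
        apply Real.sqrt_lt_sqrt (Complex.normSq_nonneg _)
        simp only [Complex.normSq_apply, Complex.sub_re, Complex.sub_im, Complex.add_re,
          Complex.add_im, Complex.I_re, Complex.I_im]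
        nlinarith
      · have h2 : cayleyInv ((w - I) / (w + I)) = w := by
          rw [cayleyInv, div_eq_iff]
          · field_simp; ring
          · have : 1 - (w - I) / (w + I) = 2 * I / (w + I) := by field_simp; ring
            rw [this]
            exact div_ne_zero (mul_ne_zero two_ne_zero I_ne_zero) h1
        simpa [h2] using hw0)
  set φ : ℝ → ℝ := fun t => 2 * Real.arctan (Real.sqrt t) + Real.pi with hφ
  have hφd : ∀ t ∈ Set.Ioi (0 : ℝ), HasDerivWithinAt φ (1 / (Real.sqrt t * (1 + t)))
      (Set.Ioi 0) t := by
    intro t ht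
    have ht0 : 0 < t := ht
    have h1 := (((Real.hasDerivAt_sqrt ht0.ne').arctan).const_mul 2).add_const Real.pi
    convert! h1.hasDerivWithinAt using 1
    rw [Real.sq_sqrt ht0.le]
    field_simp
  have hφi : Set.InjOn φ (Set.Ioi 0) := by
    intro s hs t ht hst
    have h1 : Real.arctan (Real.sqrt s) = Real.arctan (Real.sqrt t) := by
      simp only [hφ] at hst; linarith
    exact (Real.sqrt_inj (le_of_lt hs) (le_of_lt ht)).1 (Real.arctan_injective h1)
  have hφs : φ '' Set.Ioi 0 ⊆ Set.Ioc 0 (2 * Real.pi) := by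
    rintro _ ⟨t, ht, rfl⟩
    have h1 := Real.arctan_lt_pi_div_two (Real.sqrt t)
    have h2 : 0 < Real.arctan (Real.sqrt t) := Real.arctan_pos.2 (Real.sqrt_pos.2 ht)
    have := Real.pi_pos
    simp only [hφ]
    constructor <;> linarith
  refine ne_top_of_le_ne_top key ?_
  refine le_trans (le_of_eq ?_) (lintegral_mono_set hφs)
  rw [lintegral_image_eq_lintegral_abs_deriv_mul measurableSet_Ioi hφd hφi]
  refine setLIntegral_congr_fun measurableSet_Ioi fun t ht => ?_
  have ht0 : 0 < t := ht
  simp only [hφ, Function.comp_apply, cayleyInv_circleMap]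
  rw [abs_of_nonneg (by positivity)]

/-! ### The Cauchy formula in the Hardy space -/

theorem sub_ne_zero_of_im_ne {w : ℂ} (hw : w.im ≠ 0) (x : ℝ) : (x : ℂ) - w ≠ 0 := fun h => by
  have := congrArg Complex.im h
  simp at this
  exact hw this

theorem norm_ofReal_sub_sq (w : ℂ) (x : ℝ) : ‖(x : ℂ) - w‖ ^ 2 = (x - w.re) ^ 2 + w.im ^ 2 := by
  rw [Complex.sq_norm, Complex.normSq_apply]; simp; ring

theorem continuous_inv_ofReal_sub {w : ℂ} (hw : w.im ≠ 0) :
    Continuous fun x : ℝ => ((x : ℂ) - w)⁻¹ :=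
  Continuous.inv₀ (by fun_prop) (sub_ne_zero_of_im_ne hw)

theorem inv_norm_sq_eq {w : ℂ} (hw : w.im ≠ 0) (x : ℝ) :
    (‖(x : ℂ) - w‖ ^ 2)⁻¹ = (w.im ^ 2)⁻¹ * (1 + ((x - w.re) / w.im) ^ 2)⁻¹ := by
  rw [norm_ofReal_sub_sq, ← mul_inv]
  congr 1
  field_simp
  ring

theorem integrable_inv_norm_sq {w : ℂ} (hw : w.im ≠ 0) :
    Integrable fun x : ℝ => (‖(x : ℂ) - w‖ ^ 2)⁻¹ := by
  simp_rw [inv_norm_sq_eq hw]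
  have h1 := (integrable_inv_one_add_sq.comp_div hw).comp_sub_right w.re
  exact h1.const_mul _

theorem integral_inv_norm_sq {w : ℂ} (hw : w.im ≠ 0) :
    ∫ x : ℝ, (‖(x : ℂ) - w‖ ^ 2)⁻¹ = Real.pi / |w.im| := by
  simp_rw [inv_norm_sq_eq hw]
  rw [integral_const_mul, integral_sub_right_eq_self (fun x : ℝ => (1 + (x / w.im) ^ 2)⁻¹),
    Measure.integral_comp_div (fun x : ℝ => (1 + x ^ 2)⁻¹), integral_univ_inv_one_add_sq,
    smul_eq_mul, ← sq_abs w.im]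
  have : |w.im| ≠ 0 := abs_ne_zero.2 hw
  field_simp

theorem eLpNorm_two_eq (f : ℝ → ℂ) :
    eLpNorm f 2 volume = (∫⁻ x, ‖f x‖ₑ ^ 2) ^ (1 / 2 : ℝ) := by
  rw [eLpNorm_eq_lintegral_rpow_enorm_toReal two_ne_zero ENNReal.ofNat_ne_top]
  norm_num

theorem eLpNorm_inv_ofReal_sub {w : ℂ} (hw : w.im ≠ 0) :
    eLpNorm (fun x : ℝ => ((x : ℂ) - w)⁻¹) 2 volume =
      ENNReal.ofReal (Real.sqrt (Real.pi / |w.im|)) := by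
  have h1 : ∀ x : ℝ, ‖((x : ℂ) - w)⁻¹‖ₑ ^ 2 = ENNReal.ofReal ((‖(x : ℂ) - w‖ ^ 2)⁻¹) := fun x => by
    rw [← ofReal_norm, ← ENNReal.ofReal_pow (norm_nonneg _), norm_inv, inv_pow]
  rw [eLpNorm_two_eq]
  simp_rw [h1]
  rw [← ofReal_integral_eq_lintegral_ofReal (integrable_inv_norm_sq hw)
    (Eventually.of_forall fun x => by positivity), integral_inv_norm_sq hw,
    ENNReal.ofReal_rpow_of_nonneg (by positivity) (by norm_num), Real.sqrt_eq_rpow]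

theorem memLp_inv_ofReal_sub {w : ℂ} (hw : w.im ≠ 0) :
    MemLp (fun x : ℝ => ((x : ℂ) - w)⁻¹) 2 volume :=
  ⟨(continuous_inv_ofReal_sub hw).aestronglyMeasurable, by
    rw [eLpNorm_inv_ofReal_sub hw]; exact ENNReal.ofReal_lt_top⟩

/-- The Cauchy–Schwarz inequality. -/
theorem lintegral_enorm_mul_le {f g : ℝ → ℂ} (hf : AEStronglyMeasurable f volume)
    (hg : AEStronglyMeasurable g volume) :
    ∫⁻ x, ‖f x * g x‖ₑ ≤ eLpNorm f 2 volume * eLpNorm g 2 volume := by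
  have h := eLpNorm_smul_le_mul_eLpNorm (p := 2) (q := 2) (r := 1) hg hf
  rwa [eLpNorm_one_eq_lintegral_enorm] at h

/-- An integrable function is small at arbitrarily large arguments. -/
theorem frequently_norm_lt_of_integrable {V : ℝ → ℝ} (hV : Integrable V) {ε : ℝ} (hε : 0 < ε) :
    ∃ᶠ R in atTop, ‖V R‖ < ε := by
  intro h
  obtain ⟨R₀, hR₀⟩ := eventually_atTop.1 h
  have h1 := hV.measure_norm_ge_lt_top hε
  have h2 : volume (Set.Ici R₀) ≤ volume {x | ε ≤ ‖V x‖} :=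
    measure_mono fun x hx => not_lt.1 (hR₀ x hx)
  rw [Real.volume_Ici, top_le_iff] at h2
  exact h1.ne h2

/-- The integral over horizontal lines of an analytic function does not depend on the line, if the
`L¹` norms on the lines in between are bounded. The vertical sides of large rectangles are
controlled along a sequence, because by Fubini they are integrable functions of their abscissa. -/
theorem integral_eq_integral_add_mul_I {Q : ℂ → ℂ} {c Y : ℝ} (hc : c < 0) (hY : 0 ≤ Y)
    (hd : DifferentiableOn ℂ Q {w | c < w.im}) {M : ℝ≥0}
    (hM : ∀ y ∈ Set.Icc 0 Y, ∫⁻ x : ℝ, ‖Q (x + y * I)‖ₑ ≤ M) :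
    ∫ x : ℝ, Q x = ∫ x : ℝ, Q (x + Y * I) := by
  have hline : ∀ y ∈ Set.Icc 0 Y, Integrable fun x : ℝ => Q (x + y * I) := by
    intro y hy
    refine ⟨Continuous.aestronglyMeasurable ?_, (hM y hy).trans_lt ENNReal.coe_lt_top⟩
    refine hd.continuousOn.comp_continuous (by fun_prop) fun x => ?_
    simp; linarith [hy.1]
  set P : ℝ × ℝ → ℂ := fun p => Q (p.1 + p.2 * I) with hP
  have hPm : AEStronglyMeasurable P (volume.prod (volume.restrict (Set.Ioc 0 Y))) := by
    rw [← Measure.restrict_univ (μ := (volume : Measure ℝ)), Measure.restrict_restrict measurableSet_Ioc,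
      Set.inter_univ, Measure.prod_restrict]
    refine ContinuousOn.aestronglyMeasurable ?_ (MeasurableSet.univ.prod measurableSet_Ioc)
    refine hd.continuousOn.comp (by fun_prop) fun p hp => ?_
    simp only [Set.mem_prod, Set.mem_univ, true_and, Set.mem_Ioc] at hp
    simp; linarith [hp.1]
  have hPi : Integrable P (volume.prod (volume.restrict (Set.Ioc 0 Y))) := by
    refine ⟨hPm, ?_⟩
    rw [HasFiniteIntegral, lintegral_prod_symm _ hPm.enorm]
    calc ∫⁻ y in Set.Ioc 0 Y, ∫⁻ x : ℝ, ‖P (x, y)‖ₑ ≤ ∫⁻ y in Set.Ioc 0 Y, (M : ℝ≥0∞) :=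
          setLIntegral_mono measurable_const fun y hy => hM y ⟨hy.1.le, hy.2⟩
      _ < ⊤ := by
          rw [setLIntegral_const, Real.volume_Ioc]
          exact ENNReal.mul_lt_top ENNReal.coe_lt_top ENNReal.ofReal_lt_top
  set V : ℝ → ℝ := fun x => ∫ y in Set.Ioc 0 Y, ‖P (x, y)‖ with hV
  have hVi : Integrable V := hPi.integral_norm_prod_left
  have hWi : Integrable fun R => V R + V (-R) := hVi.add hVi.comp_neg
  set D : ℝ → ℂ := fun R => (∫ x in (-R)..R, Q x) - ∫ x in (-R)..R, Q (x + Y * I) with hD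
  have hDV : ∀ R : ℝ, ‖D R‖ ≤ V R + V (-R) := by
    intro R
    have h1 := Complex.integral_boundary_rect_eq_zero_of_differentiableOn Q ((-R : ℝ) : ℂ)
      ((R : ℂ) + Y * I) (hd.mono fun w hw => by
        rw [Complex.mem_reProdIm] at hw
        have h2 := hw.2
        simp [Set.uIcc_of_le hY] at h2
        simp; linarith [h2.1])
    simp only [Complex.ofReal_re, Complex.add_re, Complex.mul_re, Complex.I_re, Complex.I_im,
      Complex.ofReal_im, Complex.add_im, Complex.mul_im, mul_zero, mul_one, zero_mul, sub_zero,
      add_zero, zero_add, Complex.ofReal_zero] at h1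
    have h2 : D R = I • (∫ y in (0 : ℝ)..Y, Q ((-R : ℝ) + y * I)) -
        I • ∫ y in (0 : ℝ)..Y, Q (R + y * I) := by
      rw [hD, ← sub_eq_zero, ← h1]; ring
    have h3 : ∀ R : ℝ, ‖I • ∫ y in (0 : ℝ)..Y, Q (R + y * I)‖ ≤ V R := fun R => by
      rw [norm_smul, Complex.norm_I, one_mul, intervalIntegral.integral_of_le hY]
      exact norm_integral_le_integral_norm _
    rw [h2, add_comm]
    exact (norm_sub_le _ _).trans (add_le_add (h3 (-R)) (h3 R))
  have hDlim : Tendsto D atTop (𝓝 ((∫ x : ℝ, Q x) - ∫ x : ℝ, Q (x + Y * I))) := by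
    refine Tendsto.sub ?_ ?_
    · have := hline 0 ⟨le_rfl, hY⟩
      simp only [Complex.ofReal_zero, zero_mul, add_zero] at this
      exact intervalIntegral_tendsto_integral this tendsto_neg_atTop_atBot tendsto_id
    · exact intervalIntegral_tendsto_integral (hline Y ⟨hY, le_rfl⟩) tendsto_neg_atTop_atBot
        tendsto_id
  rw [← sub_eq_zero, ← norm_le_zero_iff]
  refine le_of_forall_pos_le_add fun ε hε => ?_
  rw [zero_add]
  by_contra! hlt
  refine frequently_norm_lt_of_integrable hWi hε ?_
  filter_upwards [hDlim.norm.eventually (lt_mem_nhds hlt)] with R hR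
  exact not_lt.2 (hR.le.trans ((hDV R).trans (le_abs_self _)))

/-- The Cauchy formula on the real line, for functions that are analytic in a larger half-plane.
The pole at `w` is removed by subtracting a multiple of `1 / (ζ - conj w)`. -/
theorem integral_mul_inv_sub_of_differentiableOn {F : ℂ → ℂ} {c : ℝ} (hc : c < 0)
    (hd : DifferentiableOn ℂ F {w | c < w.im}) {C : ℝ≥0}
    (hC : ∀ y : ℝ, 0 ≤ y → eLpNorm (fun x : ℝ => F (x + y * I)) 2 volume ≤ C)
    {w : ℂ} (hw : 0 < w.im) :
    ∫ x : ℝ, F x * ((x : ℂ) - w)⁻¹ = 2 * Real.pi * I * F w := by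
  set A : ℂ := F w * (2 * w.im * I) with hA
  set F₁ : ℂ → ℂ := fun ζ => F ζ - A * (ζ - conj w)⁻¹ with hF₁
  have hcw : w - conj w = 2 * w.im * I := by
    apply Complex.ext <;> simp; ring
  have hw2 : (2 * w.im * I : ℂ) ≠ 0 := by
    simp [hw.ne']
  have hF₁w : F₁ w = 0 := by
    simp only [hF₁, hA, hcw]; rw [mul_inv_cancel_right₀ hw2, sub_self]
  set c' := max c (-w.im) with hc'
  have hc'0 : c' < 0 := max_lt hc (by linarith)
  have hd₁ : DifferentiableOn ℂ F₁ {ζ | c' < ζ.im} := by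
    refine (hd.mono fun ζ (hζ : c' < ζ.im) => lt_of_le_of_lt (le_max_left _ _) hζ).sub ?_
    intro ζ hζ
    have : ζ - conj w ≠ 0 := fun h => by
      have h1 := congrArg Complex.im h
      have h2 : max c (-w.im) < ζ.im := hζ
      have h3 := (le_max_right c (-w.im)).trans_lt h2
      simp at h1; linarith
    fun_prop (disch := assumption)
  have hwmem : {ζ : ℂ | c' < ζ.im} ∈ 𝓝 w :=
    (isOpen_lt continuous_const Complex.continuous_im).mem_nhds (by
      show c' < w.im; linarith)
  set Q : ℂ → ℂ := dslope F₁ w with hQ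
  have hdQ : DifferentiableOn ℂ Q {ζ | c' < ζ.im} := (Complex.differentiableOn_dslope hwmem).2 hd₁
  have hQe : ∀ ζ, ζ ≠ w → Q ζ = F₁ ζ * (ζ - w)⁻¹ := fun ζ hζ => by
    rw [hQ, dslope_of_ne _ hζ, slope_def_field, hF₁w, sub_zero, div_eq_mul_inv]
  have hcont : ∀ y : ℝ, 0 ≤ y → Continuous fun x : ℝ => F₁ (x + y * I) := fun y hy =>
    hd₁.continuousOn.comp_continuous (by fun_prop) fun x => by simp; linarith
  set C₁ : ℝ≥0 := C + Real.toNNReal (‖A‖ * Real.sqrt (Real.pi / w.im)) with hC₁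
  have hF₁n : ∀ y : ℝ, 0 ≤ y → eLpNorm (fun x : ℝ => F₁ (x + y * I)) 2 volume ≤ C₁ := by
    intro y hy
    have him : (conj w - y * I).im = -(w.im + y) := by simp; ring
    have him0 : (conj w - y * I).im ≠ 0 := by rw [him]; linarith
    have h1 : (fun x : ℝ => F₁ (x + y * I)) =
        (fun x : ℝ => F (x + y * I)) - A • fun x : ℝ => ((x : ℂ) - (conj w - y * I))⁻¹ := by
      ext x; simp only [hF₁, Pi.sub_apply, Pi.smul_apply, smul_eq_mul]; ring_nf
    have hFc : Continuous fun x : ℝ => F (x + y * I) :=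
      hd.continuousOn.comp_continuous (by fun_prop) fun x => by simp; linarith
    rw [h1]
    refine (eLpNorm_sub_le hFc.aestronglyMeasurable
      ((continuous_inv_ofReal_sub him0).aestronglyMeasurable.const_smul A) one_le_two).trans ?_
    rw [hC₁, ENNReal.coe_add]
    refine add_le_add (hC y hy) ?_
    rw [eLpNorm_const_smul, eLpNorm_inv_ofReal_sub him0, ← ofReal_norm,
      ← ENNReal.ofReal_mul (norm_nonneg _), him, abs_neg, abs_of_pos (by linarith)]
    refine ENNReal.ofReal_le_ofReal ?_
    gcongr
    linarith
  have hQlarge : ∀ Y : ℝ, w.im < Y → ∫⁻ x : ℝ, ‖Q (x + Y * I)‖ₑ ≤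
      C₁ * ENNReal.ofReal (Real.sqrt (Real.pi / (Y - w.im))) := by
    intro Y hY
    have him : (w - Y * I).im = -(Y - w.im) := by simp
    have him0 : (w - Y * I).im ≠ 0 := by rw [him]; linarith
    have h1 : ∀ x : ℝ, Q (x + Y * I) = F₁ (x + Y * I) * ((x : ℂ) - (w - Y * I))⁻¹ := fun x => by
      rw [hQe]
      · ring_nf
      · intro h
        have := congrArg Complex.im h
        simp at this; linarith
    simp_rw [h1]
    refine (lintegral_enorm_mul_le (hcont Y (by linarith)).aestronglyMeasurable
      (continuous_inv_ofReal_sub him0).aestronglyMeasurable).trans ?_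
    rw [eLpNorm_inv_ofReal_sub him0, him, abs_neg, abs_of_pos (by linarith)]
    gcongr
    exact hF₁n Y (by linarith)
  have hQsmall : ∀ Y : ℝ, ∃ M : ℝ≥0, ∀ y ∈ Set.Icc 0 Y, ∫⁻ x : ℝ, ‖Q (x + y * I)‖ₑ ≤ M := by
    intro Y
    have hK : IsCompact (Set.Icc (w.re - 1) (w.re + 1) ×ℂ Set.Icc 0 Y) :=
      isCompact_Icc.reProdIm isCompact_Icc
    obtain ⟨m, hm⟩ := hK.exists_bound_of_continuousOn (hdQ.continuousOn.mono fun ζ hζ => by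
      have := (Complex.mem_reProdIm.1 hζ).2.1
      show c' < ζ.im; linarith)
    set u : ℂ := w.re + I with hu
    have huim : u.im ≠ 0 := by simp [hu]
    refine ⟨2 * (C₁ * Real.toNNReal (Real.sqrt (Real.pi / |u.im|))) + Real.toNNReal m * 2,
      fun y hy => ?_⟩
    have hpt : ∀ x : ℝ, ‖Q (x + y * I)‖ₑ ≤ 2 * ‖F₁ (x + y * I) * ((x : ℂ) - u)⁻¹‖ₑ +
        (Set.Icc (w.re - 1) (w.re + 1)).indicator (fun _ => ENNReal.ofReal m) x := by
      intro x
      by_cases hx : x ∈ Set.Icc (w.re - 1) (w.re + 1)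
      · rw [Set.indicator_of_mem hx]
        refine le_trans ?_ le_add_self
        rw [← ofReal_norm]
        refine ENNReal.ofReal_le_ofReal (hm _ ?_)
        rw [Complex.mem_reProdIm]
        exact ⟨by simpa using hx, by simpa using hy⟩
      · refine le_trans ?_ le_self_add
        have hx1 : 1 ≤ |x - w.re| := by
          by_contra! h
          rw [abs_lt] at h
          exact hx ⟨by linarith, by linarith⟩
        have hre : |x - w.re| ≤ ‖(x + y * I : ℂ) - w‖ := by
          have := Complex.abs_re_le_norm ((x + y * I : ℂ) - w)
          simpa using this
        have hne : (x + y * I : ℂ) ≠ w := fun h => by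
          rw [h, sub_self, norm_zero] at hre; linarith
        have hux : ‖(x : ℂ) - u‖ ≤ 2 * ‖(x + y * I : ℂ) - w‖ := by
          have h1 : (x : ℂ) - u = ((x - w.re : ℝ) : ℂ) - I := by rw [hu]; push_cast; ring
          rw [h1]
          refine (norm_sub_le _ _).trans ?_
          rw [Complex.norm_real, Complex.norm_I, Real.norm_eq_abs]
          linarith
        rw [hQe _ hne, ← ofReal_norm, ← ofReal_norm,
          show (2 : ℝ≥0∞) = ENNReal.ofReal 2 by simp, ← ENNReal.ofReal_mul zero_le_two]
        refine ENNReal.ofReal_le_ofReal ?_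
        rw [norm_mul, norm_mul, norm_inv, norm_inv, mul_left_comm]
        refine mul_le_mul_of_nonneg_left ?_ (norm_nonneg _)
        have h0 : 0 < ‖(x + y * I : ℂ) - w‖ := by linarith
        have h3 : 0 < ‖(x : ℂ) - u‖ := norm_pos_iff.2 (sub_ne_zero_of_im_ne huim x)
        rw [inv_eq_one_div, ← div_eq_mul_inv, div_le_div_iff₀ h0 h3]
        linarith
    calc ∫⁻ x : ℝ, ‖Q (x + y * I)‖ₑ
        ≤ ∫⁻ x : ℝ, (2 * ‖F₁ (x + y * I) * ((x : ℂ) - u)⁻¹‖ₑ +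
          (Set.Icc (w.re - 1) (w.re + 1)).indicator (fun _ => ENNReal.ofReal m) x) :=
          lintegral_mono hpt
      _ = 2 * (∫⁻ x : ℝ, ‖F₁ (x + y * I) * ((x : ℂ) - u)⁻¹‖ₑ) +
          ENNReal.ofReal m * 2 := by
          rw [lintegral_add_right _ (measurable_const.indicator measurableSet_Icc),
            lintegral_const_mul' _ _ (by simp), lintegral_indicator measurableSet_Icc,
            setLIntegral_const, Real.volume_Icc]
          congr 2
          rw [show w.re + 1 - (w.re - 1) = 2 by ring]; simp
      _ ≤ 2 * (C₁ * ENNReal.ofReal (Real.sqrt (Real.pi / |u.im|))) + ENNReal.ofReal m * 2 := by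
          gcongr
          refine (lintegral_enorm_mul_le (hcont y hy.1).aestronglyMeasurable
            (continuous_inv_ofReal_sub huim).aestronglyMeasurable).trans ?_
          rw [eLpNorm_inv_ofReal_sub huim]
          gcongr
          exact hF₁n y hy.1
      _ = _ := by
          push_cast; rfl
  have hQ0 : ∫ x : ℝ, Q x = 0 := by
    have h1 : ∀ Y : ℝ, w.im < Y → ‖∫ x : ℝ, Q x‖ₑ ≤
        C₁ * ENNReal.ofReal (Real.sqrt (Real.pi / (Y - w.im))) := by
      intro Y hY
      obtain ⟨M, hM⟩ := hQsmall Y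
      rw [integral_eq_integral_add_mul_I hc'0 (by linarith) hdQ hM]
      exact (enorm_integral_le_lintegral_enorm _).trans (hQlarge Y hY)
    have h2 : Tendsto (fun Y : ℝ => (C₁ : ℝ≥0∞) *
        ENNReal.ofReal (Real.sqrt (Real.pi / (Y - w.im)))) atTop (𝓝 (C₁ * ENNReal.ofReal 0)) := by
      refine ENNReal.Tendsto.const_mul (ENNReal.tendsto_ofReal ?_) (Or.inr ENNReal.coe_ne_top)
      have h3 : Tendsto (fun Y : ℝ => Real.pi / (Y - w.im)) atTop (𝓝 0) :=
        tendsto_const_nhds.div_atTop (tendsto_atTop_add_const_right _ _ tendsto_id)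
      have h4 := (Real.continuous_sqrt.tendsto 0).comp h3
      rwa [Real.sqrt_zero] at h4
    rw [ENNReal.ofReal_zero, mul_zero] at h2
    have h3 := ge_of_tendsto h2 ((eventually_gt_atTop w.im).mono h1)
    simpa using h3
  have hF0 : Continuous fun x : ℝ => F x :=
    hd.continuousOn.comp_continuous (by fun_prop) fun x => by simpa using hc
  have hi1 : Integrable fun x : ℝ => F x * ((x : ℂ) - w)⁻¹ := by
    have h1 : MemLp (fun x : ℝ => F x) 2 volume := ⟨hF0.aestronglyMeasurable, by
      have := hC 0 le_rfl
      simp only [Complex.ofReal_zero, zero_mul, add_zero] at this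
      exact this.trans_lt ENNReal.coe_lt_top⟩
    exact h1.integrable_mul (memLp_inv_ofReal_sub hw.ne')
  have hprod : ∀ x : ℝ, ((x : ℂ) - conj w)⁻¹ * ((x : ℂ) - w)⁻¹ =
      (((‖(x : ℂ) - w‖ ^ 2)⁻¹ : ℝ) : ℂ) := fun x => by
    rw [← mul_inv, Complex.sq_norm, Complex.ofReal_inv, ← Complex.mul_conj]
    simp [mul_comm]
  have hQx : ∀ x : ℝ, Q x = F x * ((x : ℂ) - w)⁻¹ - A * (((‖(x : ℂ) - w‖ ^ 2)⁻¹ : ℝ) : ℂ) := by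
    intro x
    rw [hQe _ (sub_ne_zero.1 (sub_ne_zero_of_im_ne hw.ne' x)), hF₁, ← hprod]
    ring
  have hi2 : Integrable fun x : ℝ => A * (((‖(x : ℂ) - w‖ ^ 2)⁻¹ : ℝ) : ℂ) :=
    (integrable_inv_norm_sq hw.ne').ofReal.const_mul A
  simp_rw [hQx] at hQ0
  rw [integral_sub hi1 hi2, integral_const_mul, integral_complex_ofReal, integral_inv_norm_sq hw.ne', abs_of_pos hw, sub_eq_zero] at hQ0
  rw [hQ0, hA]
  have : (w.im : ℂ) ≠ 0 := by exact_mod_cast hw.ne'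
  push_cast
  field_simp

/-- The Cauchy formula: a Hardy function is the Cauchy integral of its boundary function. -/
theorem IsHardyTwo.integral_mul_inv_sub {F : ℂ → ℂ} (hF : IsHardyTwo F)
    {f : Lp ℂ 2 (volume : Measure ℝ)} (hf : IsBoundaryFunction F f) {w : ℂ} (hw : 0 < w.im) :
    ∫ x : ℝ, f x * ((x : ℂ) - w)⁻¹ = 2 * Real.pi * I * F w := by
  obtain ⟨hd, C, hC⟩ := hF
  have hFc : ∀ y : ℝ, 0 < y → Continuous fun x : ℝ => F (x + y * I) := fun y hy =>
    hd.continuousOn.comp_continuous (by fun_prop) fun x => by simpa using hy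
  have hFm : ∀ y : ℝ, 0 < y → MemLp (fun x : ℝ => F (x + y * I)) 2 volume := fun y hy =>
    ⟨(hFc y hy).aestronglyMeasurable, (hC y hy).trans_lt ENNReal.coe_lt_top⟩
  have hk := memLp_inv_ofReal_sub (w := w) hw.ne'
  have hy : ∀ y : ℝ, 0 < y → ∫ x : ℝ, F (x + y * I) * ((x : ℂ) - w)⁻¹ =
      2 * Real.pi * I * F (w + y * I) := by
    intro y hy
    refine integral_mul_inv_sub_of_differentiableOn (F := fun ζ => F (ζ + y * I)) (c := -y)
      (by linarith) ?_ (C := C) (fun y' hy' => ?_) hw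
    · refine hd.comp (by fun_prop) fun ζ (hζ : -y < ζ.im) => ?_
      simp; linarith
    · have := hC (y' + y) (by linarith)
      convert! this using 4
      push_cast; ring
  have hlim1 : Tendsto (fun y : ℝ => ∫ x : ℝ, F (x + y * I) * ((x : ℂ) - w)⁻¹) (𝓝[>] 0)
      (𝓝 (∫ x : ℝ, f x * ((x : ℂ) - w)⁻¹)) := by
    rw [tendsto_iff_edist_tendsto_0]
    have h1 : Tendsto (fun y : ℝ => eLpNorm (fun x : ℝ => F (x + y * I) - f x) 2 volume *
        eLpNorm (fun x : ℝ => ((x : ℂ) - w)⁻¹) 2 volume) (𝓝[>] 0) (𝓝 0) := by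
      have := ENNReal.Tendsto.mul_const (b := eLpNorm (fun x : ℝ => ((x : ℂ) - w)⁻¹) 2 volume) hf
        (Or.inr hk.2.ne)
      rwa [zero_mul] at this
    refine tendsto_of_tendsto_of_tendsto_of_le_of_le' tendsto_const_nhds h1
      (Eventually.of_forall fun _ => zero_le) ?_
    filter_upwards [self_mem_nhdsWithin] with y hy
    have hi1 : Integrable fun x : ℝ => F (x + y * I) * ((x : ℂ) - w)⁻¹ :=
      (hFm y hy).integrable_mul hk
    have hi2 : Integrable fun x : ℝ => f x * ((x : ℂ) - w)⁻¹ := (Lp.memLp f).integrable_mul hk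
    rw [edist_eq_enorm_sub, ← integral_sub hi1 hi2]
    simp_rw [← sub_mul]
    exact (enorm_integral_le_lintegral_enorm _).trans (lintegral_enorm_mul_le
      ((hFc y hy).aestronglyMeasurable.sub (Lp.aestronglyMeasurable f)) hk.1)
  have hlim2 : Tendsto (fun y : ℝ => 2 * Real.pi * I * F (w + y * I)) (𝓝[>] 0)
      (𝓝 (2 * Real.pi * I * F w)) := by
    refine Tendsto.const_mul _ ?_
    have h1 : ContinuousAt F w :=
      hd.continuousOn.continuousAt (isOpen_upperHalfPlane.mem_nhds hw)
    have h2 : Tendsto (fun y : ℝ => w + y * I) (𝓝[>] 0) (𝓝 w) := by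
      have : Continuous fun y : ℝ => w + y * I := by fun_prop
      simpa using (this.tendsto 0).mono_left nhdsWithin_le_nhds
    exact h1.tendsto.comp h2
  refine tendsto_nhds_unique hlim1 (hlim2.congr' ?_)
  filter_upwards [self_mem_nhdsWithin] with y hy' using (hy y hy').symm

/-! ### Orthogonality to the Cauchy kernels -/

theorem continuous_blaschkeBeta_ofReal {β : ℝ} (hβ : 1 / 2 < β) :
    Continuous fun x : ℝ => blaschkeBeta β x :=
  (isBlaschkeSeq_zeroBeta hβ).continuousOn_blaschkeProduct.comp_continuous
    Complex.continuous_ofReal fun x => by simp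

theorem norm_inv_add_mul_I_sub_conj_le {w : ℂ} (hw : 0 < w.im) {y : ℝ} (hy : 0 ≤ y) (x : ℝ) :
    ‖((x : ℂ) + y * I - conj w)⁻¹‖ ≤ ‖((x : ℂ) - conj w)⁻¹‖ := by
  rw [norm_inv, norm_inv]
  refine inv_anti₀ (norm_pos_iff.2 (sub_conj_ne_zero_of_im hw (by simp))) ?_
  rw [Complex.norm_def, Complex.norm_def]
  apply Real.sqrt_le_sqrt
  simp only [Complex.normSq_apply, Complex.sub_re, Complex.sub_im, Complex.add_re, Complex.add_im,
    Complex.mul_re, Complex.mul_im, Complex.I_re, Complex.I_im, Complex.ofReal_re,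
    Complex.ofReal_im, Complex.conj_re, Complex.conj_im]
  nlinarith

theorem isHardyTwo_inv_sub_conj {w : ℂ} (hw : 0 < w.im) :
    IsHardyTwo fun ζ => (ζ - conj w)⁻¹ := by
  have him : (conj w).im ≠ 0 := by simpa using hw.ne'
  refine ⟨fun ζ hζ => ?_, Real.toNNReal (Real.sqrt (Real.pi / |(conj w).im|)), fun y hy => ?_⟩
  · have := sub_conj_ne_zero_of_im hw (le_of_lt hζ)
    fun_prop (disch := assumption)
  · refine (eLpNorm_mono (norm_inv_add_mul_I_sub_conj_le hw hy.le)).trans ?_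
    rw [eLpNorm_inv_ofReal_sub him, ENNReal.ofReal]

/-- The functions `B(t) / (t - conj w)` belong to `B H²`. -/
theorem exists_mulHardySpace_eq {β : ℝ} (hβ : 1 / 2 < β) {w : ℂ} (hw : 0 < w.im) :
    ∃ g ∈ mulHardySpace (blaschkeBeta β),
      g =ᵐ[volume] fun x : ℝ => blaschkeBeta β x * ((x : ℂ) - conj w)⁻¹ := by
  have ha := isBlaschkeSeq_zeroBeta hβ
  have him : (conj w).im ≠ 0 := by simpa using hw.ne'
  have hk := memLp_inv_ofReal_sub him
  have hB : Continuous fun x : ℝ => blaschkeBeta β x := continuous_blaschkeBeta_ofReal hβ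
  have hBc : ContinuousOn (blaschkeBeta β) {ζ | 0 ≤ ζ.im} := ha.continuousOn_blaschkeProduct
  have hB1 : ∀ ζ : ℂ, 0 ≤ ζ.im → ‖blaschkeBeta β ζ‖ ≤ 1 := fun ζ hζ =>
    ha.norm_blaschkeProduct_le_one hζ
  have hg : MemLp (fun x : ℝ => blaschkeBeta β x * ((x : ℂ) - conj w)⁻¹) 2 volume := by
    refine hk.mono (hB.aestronglyMeasurable.mul hk.1) (Eventually.of_forall fun x => ?_)
    rw [norm_mul]
    exact mul_le_of_le_one_left (norm_nonneg _) (hB1 x (by simp))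
  refine ⟨hg.toLp _, ⟨fun ζ => (ζ - conj w)⁻¹, isHardyTwo_inv_sub_conj hw, ?_⟩, hg.coeFn_toLp⟩
  set P : ℝ → ℝ → ℂ := fun y x =>
    blaschkeBeta β (x + y * I) * ((x : ℂ) + y * I - conj w)⁻¹ -
      blaschkeBeta β x * ((x : ℂ) - conj w)⁻¹ with hP
  have hPc : ∀ y : ℝ, 0 < y → Continuous (P y) := fun y hy => by
    refine Continuous.sub (Continuous.mul ?_ (Continuous.inv₀ (by fun_prop) fun x => ?_))
      (hB.mul (continuous_inv_ofReal_sub him))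
    · exact hBc.comp_continuous (by fun_prop) fun x => by simpa using hy.le
    · exact sub_conj_ne_zero_of_im hw (by simpa using hy.le)
  have hlim : Tendsto (fun y : ℝ => ∫⁻ x, ‖P y x‖ₑ ^ 2) (𝓝[>] 0) (𝓝 (∫⁻ _ : ℝ, 0)) := by
    refine tendsto_lintegral_filter_of_dominated_convergence
      (fun x => 4 * ‖((x : ℂ) - conj w)⁻¹‖ₑ ^ 2) ?_ ?_ ?_ ?_
    · filter_upwards [self_mem_nhdsWithin] with y hy
      exact (hPc y hy).enorm.measurable.pow_const 2
    · filter_upwards [self_mem_nhdsWithin] with y hy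
      refine Eventually.of_forall fun x => ?_
      have hy0 : (0 : ℝ) < y := hy
      have h1 : ‖P y x‖ ≤ 2 * ‖((x : ℂ) - conj w)⁻¹‖ := by
        refine (norm_sub_le _ _).trans ?_
        rw [norm_mul, norm_mul, two_mul]
        refine add_le_add ?_ (mul_le_of_le_one_left (norm_nonneg _) (hB1 x (by simp)))
        exact (mul_le_of_le_one_left (norm_nonneg _) (hB1 _ (by simpa using hy0.le))).trans
          (norm_inv_add_mul_I_sub_conj_le hw hy0.le x)
      have h2 : ‖P y x‖ₑ ≤ 2 * ‖((x : ℂ) - conj w)⁻¹‖ₑ := by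
        rw [← ofReal_norm, ← ofReal_norm, show (2 : ℝ≥0∞) = ENNReal.ofReal 2 by simp,
          ← ENNReal.ofReal_mul zero_le_two]
        exact ENNReal.ofReal_le_ofReal h1
      calc ‖P y x‖ₑ ^ 2 ≤ (2 * ‖((x : ℂ) - conj w)⁻¹‖ₑ) ^ 2 := by gcongr
        _ = _ := by rw [mul_pow]; norm_num
    · rw [lintegral_const_mul' _ _ (by simp)]
      refine ENNReal.mul_ne_top (by simp) fun htop => hk.2.ne ?_
      rw [eLpNorm_two_eq, htop]; simp
    · refine Eventually.of_forall fun x => ?_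
      have h1 : ContinuousWithinAt (fun ζ : ℂ => blaschkeBeta β ζ * (ζ - conj w)⁻¹)
          {ζ | 0 ≤ ζ.im} x := by
        refine (hBc x (by simp)).mul (ContinuousWithinAt.inv₀ (by fun_prop) ?_)
        exact sub_conj_ne_zero_of_im hw (by simp)
      have h2 : Tendsto (fun y : ℝ => (x : ℂ) + y * I) (𝓝[>] 0) (𝓝[{ζ : ℂ | 0 ≤ ζ.im}] x) := by
        refine tendsto_nhdsWithin_iff.2 ⟨?_, ?_⟩
        · have : Continuous fun y : ℝ => (x : ℂ) + y * I := by fun_prop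
          simpa using (this.tendsto 0).mono_left nhdsWithin_le_nhds
        · filter_upwards [self_mem_nhdsWithin] with y hy
          simpa using le_of_lt hy
      have h3 := (h1.tendsto.comp h2).sub_const (blaschkeBeta β x * ((x : ℂ) - conj w)⁻¹)
      rw [sub_self] at h3
      have h4 := (ENNReal.continuous_pow 2).tendsto _ |>.comp h3.enorm
      simpa [Function.comp_def] using h4
  have hlim2 : Tendsto (fun y : ℝ => eLpNorm (P y) 2 volume) (𝓝[>] 0) (𝓝 0) := by
    simp_rw [eLpNorm_two_eq]
    have := (ENNReal.continuous_rpow_const (y := (1 / 2 : ℝ))).tendsto _ |>.comp hlim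
    simpa [Function.comp_def] using this
  refine hlim2.congr fun y => eLpNorm_congr_ae ?_
  filter_upwards [hg.coeFn_toLp] with x hx
  rw [hx]

theorem integral_mul_conj_blaschkeBeta_eq_zero {β : ℝ} (hβ : 1 / 2 < β)
    {f : Lp ℂ 2 (volume : Measure ℝ)} (hf : f ∈ modelSpace (blaschkeBeta β)) {w : ℂ}
    (hw : 0 < w.im) :
    ∫ x : ℝ, f x * conj (blaschkeBeta β x) * ((x : ℂ) - w)⁻¹ = 0 := by
  obtain ⟨g, hg, hge⟩ := exists_mulHardySpace_eq hβ hw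
  rw [← hf.2 g hg, L2.inner_def]
  refine integral_congr_ae ?_
  filter_upwards [hge] with x hx
  rw [hx, RCLike.inner_apply]
  simp [mul_assoc]

/-! ### Analytic dependence of integrals on a parameter -/

/-- An integral depends holomorphically on a parameter, if the integrand does and is locally
dominated. -/
theorem differentiableOn_integral_of_locally_dominated {k : ℂ → ℝ → ℂ} {U : Set ℂ}
    (hU : IsOpen U) (hm : ∀ ζ ∈ U, AEStronglyMeasurable (k ζ) volume)
    (hd : ∀ t, DifferentiableOn ℂ (fun ζ => k ζ t) U)
    (hb : ∀ ζ₀ ∈ U, ∃ r > 0, ∃ b : ℝ → ℝ, Integrable b ∧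
      ∀ t, ∀ ζ ∈ Metric.ball ζ₀ r ∩ U, ‖k ζ t‖ ≤ b t) :
    DifferentiableOn ℂ (fun ζ => ∫ t, k ζ t) U := by
  intro ζ₀ hζ₀
  obtain ⟨r₁, hr₁, b, hbi, hb⟩ := hb ζ₀ hζ₀
  obtain ⟨r₂, hr₂, hball⟩ := Metric.isOpen_iff.1 hU ζ₀ hζ₀
  set r := min r₁ r₂ with hr
  have hr0 : 0 < r := lt_min hr₁ hr₂
  have hrU : Metric.ball ζ₀ r ⊆ U := (Metric.ball_subset_ball (min_le_right _ _)).trans hball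
  have hrb : ∀ t, ∀ ζ ∈ Metric.ball ζ₀ r, ‖k ζ t‖ ≤ b t := fun t ζ hζ =>
    hb t ζ ⟨Metric.ball_subset_ball (min_le_left _ _) hζ, hrU hζ⟩
  have hat : ∀ t, ∀ ζ ∈ U, HasDerivAt (fun ζ => k ζ t) (deriv (fun ζ => k ζ t) ζ) ζ :=
    fun t ζ hζ => ((hd t).differentiableAt (hU.mem_nhds hζ)).hasDerivAt
  have hder : ∀ t, ∀ ζ ∈ Metric.ball ζ₀ (r / 2),
      ‖deriv (fun ζ => k ζ t) ζ‖ ≤ b t / (r / 4) := by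
    intro t ζ hζ
    have hsub : Metric.closedBall ζ (r / 4) ⊆ Metric.ball ζ₀ r := by
      intro z hz
      rw [Metric.mem_closedBall] at hz
      rw [Metric.mem_ball] at hζ ⊢
      have := dist_triangle z ζ ζ₀
      linarith
    refine Complex.norm_deriv_le_of_forall_mem_sphere_norm_le (by linarith) ?_ fun z hz =>
      hrb t z (hsub (Metric.sphere_subset_closedBall hz))
    refine DifferentiableOn.diffContOnCl ?_
    rw [closure_ball _ (by linarith)]
    exact (hd t).mono (hsub.trans hrU)
  have hmeas' : AEStronglyMeasurable (fun t => deriv (fun ζ => k ζ t) ζ₀) volume := by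
    obtain ⟨N, hN⟩ := exists_nat_gt (1 / r)
    have hpos : ∀ n : ℕ, (0 : ℝ) < n + N + 1 := fun n => by positivity
    set u : ℕ → ℂ := fun n => ζ₀ + ((1 / ((n : ℝ) + N + 1) : ℝ) : ℂ) with hu
    have hlim0 : Tendsto (fun n : ℕ => 1 / ((n : ℝ) + N + 1)) atTop (𝓝 0) := by
      refine tendsto_const_nhds.div_atTop ?_
      refine tendsto_atTop_add_const_right _ _ (tendsto_atTop_add_const_right _ _ ?_)
      exact tendsto_natCast_atTop_atTop
    have hulim : Tendsto u atTop (𝓝[≠] ζ₀) := by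
      refine tendsto_nhdsWithin_iff.2 ⟨?_, Eventually.of_forall fun n => ?_⟩
      · simpa [hu] using ((Complex.continuous_ofReal.tendsto 0).comp hlim0).const_add ζ₀
      · simp only [hu, Set.mem_compl_iff, Set.mem_singleton_iff, add_eq_left,
          Complex.ofReal_eq_zero]
        exact (one_div_pos.2 (hpos n)).ne'
    have huU : ∀ n, u n ∈ U := fun n => hrU (by
      have h2 : (1 : ℝ) / r < n + N + 1 := by linarith [Nat.cast_nonneg (α := ℝ) n]
      rw [Metric.mem_ball, dist_eq_norm]
      simp only [hu, add_sub_cancel_left, Complex.norm_real, Real.norm_eq_abs]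
      rw [abs_of_pos (one_div_pos.2 (hpos n))]
      exact (one_div_lt hr0 (hpos n)).1 h2)
    refine aestronglyMeasurable_of_tendsto_ae atTop
      (f := fun n t => slope (fun ζ => k ζ t) ζ₀ (u n)) (fun n => ?_)
      (Eventually.of_forall fun t => (hasDerivAt_iff_tendsto_slope.1 (hat t ζ₀ hζ₀)).comp hulim)
    simp only [slope_def_module]
    exact ((hm _ (huU n)).sub (hm _ hζ₀)).const_smul (u n - ζ₀)⁻¹
  have hnhds : Metric.ball ζ₀ (r / 2) ∈ 𝓝 ζ₀ := Metric.ball_mem_nhds _ (by linarith)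
  have hsub' : Metric.ball ζ₀ (r / 2) ⊆ Metric.ball ζ₀ r :=
    Metric.ball_subset_ball (by linarith)
  exact (hasDerivAt_integral_of_dominated_loc_of_deriv_le hnhds
    (Filter.mem_of_superset (hU.mem_nhds hζ₀) hm)
    (hbi.mono' (hm _ hζ₀) (Eventually.of_forall fun t => hrb t ζ₀ (Metric.mem_ball_self hr0)))
    hmeas' (Eventually.of_forall hder) (hbi.div_const _)
    (Eventually.of_forall fun t ζ hζ => hat t ζ (hrU (hsub' hζ)))).2.differentiableAt
    |>.differentiableWithinAt

/-! ### The extension of a function of the model space to the slit plane -/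

/-- The numerator `E(ζ) - A(ζ) conj B(t)` of the kernel, where `A` and `E` are the Blaschke products
over the first- and the second-quadrant roots. It vanishes when `ζ ^ 2 = t`. -/
def slitNumerator (β : ℝ) (ζ : ℂ) (t : ℝ) : ℂ :=
  reflectedRootProduct β ζ - rootProduct β ζ * conj (blaschkeBeta β t)

/-- The kernel of the extension in the uniformizing variable `ζ` of the slit plane, `w = ζ ^ 2`. -/
def slitKernel (β : ℝ) (ζ : ℂ) (t : ℝ) : ℂ := slitNumerator β ζ t * ((t : ℂ) - ζ ^ 2)⁻¹

/-- The function `E(ζ) f(ζ ^ 2)` on the upper half-plane, where `f` is extended analytically from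
the upper half-plane across the negative half-line. The factor `E` cancels the poles of the
extension, so that no singularities remain. -/
def slitExtension (β : ℝ) (f : ℝ → ℂ) (ζ : ℂ) : ℂ :=
  (2 * Real.pi * I)⁻¹ * ∫ t : ℝ, f t * slitKernel β ζ t

theorem norm_rootProduct_le_one {β : ℝ} (hβ : 2 / 3 < β) {ζ : ℂ} (hζ : 0 ≤ ζ.im) :
    ‖rootProduct β ζ‖ ≤ 1 := (isBlaschkeSeq_sqrtZero hβ).norm_blaschkeProduct_le_one hζ

theorem norm_reflectedRootProduct_le_one {β : ℝ} (hβ : 2 / 3 < β) {ζ : ℂ} (hζ : 0 ≤ ζ.im) :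
    ‖reflectedRootProduct β ζ‖ ≤ 1 :=
  (isBlaschkeSeq_sqrtZero hβ).neg_conj.norm_blaschkeProduct_le_one hζ

theorem norm_blaschkeBeta_ofReal {β : ℝ} (hβ : 1 / 2 < β) (t : ℝ) : ‖blaschkeBeta β t‖ = 1 :=
  (isBlaschkeSeq_zeroBeta hβ).norm_blaschkeProduct_ofReal t

theorem norm_slitNumerator_le_two {β : ℝ} (hβ : 2 / 3 < β) {ζ : ℂ} (hζ : 0 ≤ ζ.im) (t : ℝ) :
    ‖slitNumerator β ζ t‖ ≤ 2 := by
  refine (norm_sub_le _ _).trans ?_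
  rw [norm_mul, Complex.norm_conj, norm_blaschkeBeta_ofReal (by linarith), mul_one]
  linarith [norm_rootProduct_le_one hβ hζ, norm_reflectedRootProduct_le_one hβ hζ]

/-- On either quadrant the numerator is a difference of values of `B` in the closed upper
half-plane, up to a bounded factor; here the symmetry of the two root products is used. -/
theorem exists_norm_slitNumerator_le {β : ℝ} (hβ : 2 / 3 < β) :
    ∃ C : ℝ, 0 ≤ C ∧ ∀ (ζ : ℂ) (t : ℝ), 0 ≤ ζ.im →
      ‖slitNumerator β ζ t‖ ≤ C * ‖(t : ℂ) - ζ ^ 2‖ * (1 + ‖ζ‖ ^ 2) * (1 + |t|) := by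
  have hβ' : 1 / 2 < β := by linarith
  obtain ⟨C, hC0, hC⟩ := exists_norm_blaschkeBeta_sub_le hβ'
  refine ⟨C, hC0, fun ζ t hζ => ?_⟩
  have ht : blaschkeBeta β t * conj (blaschkeBeta β t) = 1 := by
    rw [Complex.mul_conj, Complex.normSq_eq_norm_sq, norm_blaschkeBeta_ofReal hβ']; simp
  rcases le_total 0 ζ.re with hre | hre
  · have hw : 0 ≤ (ζ ^ 2).im := by rw [sq, Complex.mul_im]; nlinarith [mul_nonneg hre hζ]
    have h1 : slitNumerator β ζ t = reflectedRootProduct β ζ * conj (blaschkeBeta β t) *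
        (blaschkeBeta β t - blaschkeBeta β (ζ ^ 2)) := by
      rw [slitNumerator, rootProduct_eq hβ hre hζ]
      linear_combination (-reflectedRootProduct β ζ) * ht
    rw [h1, norm_mul, norm_mul, Complex.norm_conj, norm_blaschkeBeta_ofReal hβ', mul_one]
    refine (mul_le_of_le_one_left (norm_nonneg _) (norm_reflectedRootProduct_le_one hβ hζ)).trans ?_
    simpa using hC t (ζ ^ 2) (by simp) hw
  · have hw : 0 ≤ (conj ζ ^ 2).im := by
      rw [sq, Complex.mul_im, Complex.conj_re, Complex.conj_im]
      nlinarith [mul_nonneg (neg_nonneg.2 hre) hζ]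
    have h1 : slitNumerator β ζ t =
        -(rootProduct β ζ * conj (blaschkeBeta β t - blaschkeBeta β (conj ζ ^ 2))) := by
      rw [slitNumerator, reflectedRootProduct_eq hβ hre hζ, map_sub]
      ring
    have h2 : ‖(t : ℂ) - conj ζ ^ 2‖ = ‖(t : ℂ) - ζ ^ 2‖ := by
      rw [← Complex.norm_conj]; simp
    rw [h1, norm_neg, norm_mul, Complex.norm_conj]
    refine (mul_le_of_le_one_left (norm_nonneg _) (norm_rootProduct_le_one hβ hζ)).trans ?_
    simpa [h2] using hC t (conj ζ ^ 2) (by simp) hw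

theorem norm_ofReal_sub_I_le (t : ℝ) : ‖(t : ℂ) - I‖ ≤ 1 + |t| := by
  refine (norm_sub_le _ _).trans ?_
  rw [Complex.norm_real, Complex.norm_I, Real.norm_eq_abs, add_comm]

theorem exists_norm_slitKernel_le {β : ℝ} (hβ : 2 / 3 < β) :
    ∃ C : ℝ, 0 ≤ C ∧ ∀ (ζ : ℂ) (t : ℝ), 0 ≤ ζ.im →
      ‖slitKernel β ζ t‖ ≤ C * (1 + ‖ζ‖ ^ 2) ^ 3 * ‖((t : ℂ) - I)⁻¹‖ := by
  obtain ⟨C, hC0, hC⟩ := exists_norm_slitNumerator_le hβ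
  refine ⟨4 * C + 4, by positivity, fun ζ t hζ => ?_⟩
  have hI : (0 : ℝ) < ‖(t : ℂ) - I‖ :=
    norm_pos_iff.2 (sub_ne_zero_of_im_ne (by simp) t)
  set q := 1 + ‖ζ‖ ^ 2 with hq
  have hq1 : 1 ≤ q := by rw [hq]; linarith [sq_nonneg ‖ζ‖]
  have hq2 : q ≤ q ^ 3 := le_self_pow₀ hq1 (by norm_num)
  rw [norm_inv (_ - I), ← div_eq_mul_inv, le_div_iff₀ hI]
  rw [slitKernel, norm_mul, norm_inv]
  set d := ‖(t : ℂ) - ζ ^ 2‖ with hd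
  have hd0 : 0 ≤ d := norm_nonneg _
  have ht : |t| ≤ ‖ζ‖ ^ 2 + d := by
    have h1 : (t : ℂ) = ζ ^ 2 + ((t : ℂ) - ζ ^ 2) := by ring
    have h2 := norm_add_le (ζ ^ 2) ((t : ℂ) - ζ ^ 2)
    rw [← h1, Complex.norm_real, norm_pow, Real.norm_eq_abs] at h2
    exact h2
  have ht' : 1 + |t| ≤ q + d := by rw [hq]; linarith
  have hti : ‖(t : ℂ) - I‖ ≤ q + d := (norm_ofReal_sub_I_le t).trans ht'
  rcases hd0.eq_or_lt with h0 | h0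
  · rw [← h0]; simp; positivity
  have hN1 := hC ζ t hζ
  have hN2 := norm_slitNumerator_le_two hβ hζ t
  rw [← hd, ← hq] at hN1
  set N := ‖slitNumerator β ζ t‖ with hN
  have hN0 : 0 ≤ N := norm_nonneg _
  rw [← div_eq_mul_inv, div_mul_eq_mul_div, div_le_iff₀ h0]
  rcases le_total d 1 with h1 | h1
  · have e1 : 1 + |t| ≤ 2 * q := by linarith
    have e2 : ‖(t : ℂ) - I‖ ≤ 2 * q := by linarith
    calc N * ‖(t : ℂ) - I‖ ≤ (C * d * q * (2 * q)) * (2 * q) := by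
          gcongr
          exact hN1.trans (by gcongr)
      _ = 4 * C * q ^ 3 * d := by ring
      _ ≤ (4 * C + 4) * q ^ 3 * d := by gcongr; linarith
  · have e2 : ‖(t : ℂ) - I‖ ≤ 2 * q * d := by nlinarith
    calc N * ‖(t : ℂ) - I‖ ≤ 2 * (2 * q * d) := by gcongr
      _ = 4 * q * d := by ring
      _ ≤ (4 * C + 4) * q ^ 3 * d := by gcongr; linarith

theorem integrable_norm_mul_norm_inv_sub_I (f : Lp ℂ 2 (volume : Measure ℝ)) :
    Integrable fun t : ℝ => ‖f t‖ * ‖((t : ℂ) - I)⁻¹‖ := by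
  have h := ((Lp.memLp f).integrable_mul (memLp_inv_ofReal_sub (w := I) (by simp))).norm
  simpa using h

theorem ae_ofReal_ne (w : ℂ) : ∀ᵐ t : ℝ, (t : ℂ) ≠ w := by
  have h : {t : ℝ | (t : ℂ) = w}.Subsingleton := fun s hs t ht =>
    Complex.ofReal_injective ((show (s : ℂ) = w from hs).trans (show (t : ℂ) = w from ht).symm)
  rw [ae_iff]
  simpa using h.measure_zero volume

theorem measurable_slitKernel {β : ℝ} (hβ : 2 / 3 < β) (ζ : ℂ) : Measurable (slitKernel β ζ) := by
  have h1 : Continuous fun t : ℝ => blaschkeBeta β t :=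
    continuous_blaschkeBeta_ofReal (by linarith)
  have h2 : Measurable fun t : ℝ => slitNumerator β ζ t := by
    unfold slitNumerator
    exact (continuous_const.sub (continuous_const.mul (Complex.continuous_conj.comp h1))).measurable
  exact h2.mul (by fun_prop)

theorem continuousOn_slitNumerator {β : ℝ} (hβ : 2 / 3 < β) (t : ℝ) :
    ContinuousOn (fun ζ => slitNumerator β ζ t) {ζ | 0 ≤ ζ.im} :=
  (isBlaschkeSeq_sqrtZero hβ).neg_conj.continuousOn_blaschkeProduct.sub
    ((isBlaschkeSeq_sqrtZero hβ).continuousOn_blaschkeProduct.mul continuousOn_const)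

theorem differentiableOn_slitNumerator {β : ℝ} (hβ : 2 / 3 < β) (t : ℝ) :
    DifferentiableOn ℂ (fun ζ => slitNumerator β ζ t) {ζ | 0 < ζ.im} :=
  (isBlaschkeSeq_sqrtZero hβ).neg_conj.differentiableOn_blaschkeProduct.sub
    ((isBlaschkeSeq_sqrtZero hβ).differentiableOn_blaschkeProduct.mul_const _)

theorem exists_norm_slitExtension_le {β : ℝ} (hβ : 2 / 3 < β)
    (f : Lp ℂ 2 (volume : Measure ℝ)) :
    ∃ C : ℝ, ∀ ζ : ℂ, 0 ≤ ζ.im → ‖slitExtension β f ζ‖ ≤ C * (1 + ‖ζ‖ ^ 2) ^ 3 := by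
  obtain ⟨C, hC0, hC⟩ := exists_norm_slitKernel_le hβ
  set M := ∫ t : ℝ, ‖f t‖ * ‖((t : ℂ) - I)⁻¹‖ with hM
  refine ⟨‖(2 * Real.pi * I : ℂ)⁻¹‖ * (C * M), fun ζ hζ => ?_⟩
  rw [slitExtension, norm_mul, mul_assoc _ (C * M)]
  refine mul_le_mul_of_nonneg_left ?_ (norm_nonneg _)
  have h1 : ∀ t : ℝ, ‖f t * slitKernel β ζ t‖ ≤
      C * (1 + ‖ζ‖ ^ 2) ^ 3 * (‖f t‖ * ‖((t : ℂ) - I)⁻¹‖) := fun t => by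
    rw [norm_mul, mul_left_comm]
    exact mul_le_mul_of_nonneg_left (hC ζ t hζ) (norm_nonneg _)
  refine (norm_integral_le_of_norm_le ((integrable_norm_mul_norm_inv_sub_I f).const_mul _)
    (Eventually.of_forall h1)).trans ?_
  rw [integral_const_mul]
  exact le_of_eq (by ring)

/-- The kernel is dominated locally uniformly in `ζ`. -/
theorem norm_mul_slitKernel_le {C : ℝ} (hC0 : 0 ≤ C) {K : ℂ → ℝ → ℂ} {s : Set ℂ}
    (hC : ∀ ζ ∈ s, ∀ t : ℝ, ‖K ζ t‖ ≤ C * (1 + ‖ζ‖ ^ 2) ^ 3 * ‖((t : ℂ) - I)⁻¹‖) (f : ℝ → ℂ)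
    {ζ₀ ζ : ℂ} (hζ : ζ ∈ s) (hball : ζ ∈ Metric.ball ζ₀ 1) (t : ℝ) :
    ‖f t * K ζ t‖ ≤
      C * (1 + (‖ζ₀‖ + 1) ^ 2) ^ 3 * (‖f t‖ * ‖((t : ℂ) - I)⁻¹‖) := by
  have h1 : ‖ζ‖ ≤ ‖ζ₀‖ + 1 := by
    rw [mem_ball_iff_norm] at hball
    have := norm_sub_norm_le ζ ζ₀
    linarith
  rw [norm_mul, mul_left_comm]
  refine mul_le_mul_of_nonneg_left ((hC ζ hζ t).trans ?_) (norm_nonneg _)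
  gcongr

theorem continuousOn_slitExtension {β : ℝ} (hβ : 2 / 3 < β) (f : Lp ℂ 2 (volume : Measure ℝ)) :
    ContinuousOn (slitExtension β f) {ζ | 0 ≤ ζ.im} := by
  obtain ⟨C, hC0, hC⟩ := exists_norm_slitKernel_le hβ
  refine continuousOn_const.mul fun ζ₀ hζ₀ => ?_
  refine continuousWithinAt_of_dominated
    (bound := fun t => C * (1 + (‖ζ₀‖ + 1) ^ 2) ^ 3 * (‖f t‖ * ‖((t : ℂ) - I)⁻¹‖)) ?_ ?_
    ((integrable_norm_mul_norm_inv_sub_I f).const_mul _) ?_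
  · exact Eventually.of_forall fun ζ =>
      (Lp.aestronglyMeasurable f).mul (measurable_slitKernel hβ ζ).aestronglyMeasurable
  · filter_upwards [self_mem_nhdsWithin,
      mem_nhdsWithin_of_mem_nhds (Metric.ball_mem_nhds ζ₀ one_pos)] with ζ hζ hball
    exact Eventually.of_forall fun t =>
      norm_mul_slitKernel_le hC0 (s := {ζ | 0 ≤ ζ.im}) (fun ζ hζ t => hC ζ t hζ) f hζ hball t
  · filter_upwards [ae_ofReal_ne (ζ₀ ^ 2)] with t ht
    refine continuousWithinAt_const.mul ((continuousOn_slitNumerator hβ t ζ₀ hζ₀).mul ?_)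
    exact ContinuousWithinAt.inv₀ (by fun_prop) (sub_ne_zero.2 ht)

/-- The kernel with its removable singularity at `ζ = i √|t|`, `t < 0`, removed. -/
def slitKernelReg (β : ℝ) (ζ : ℂ) (t : ℝ) : ℂ :=
  if t < 0 then
    -(dslope (fun ζ => slitNumerator β ζ t) (Real.sqrt (-t) * I) ζ * (ζ + Real.sqrt (-t) * I)⁻¹)
  else slitKernel β ζ t

theorem sqrt_neg_mul_I_sq {t : ℝ} (ht : t < 0) : ((Real.sqrt (-t) : ℂ) * I) ^ 2 = t := by
  rw [mul_pow, I_sq, ← Complex.ofReal_pow, Real.sq_sqrt (by linarith)]; push_cast; ring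

theorem slitKernelReg_eq {β : ℝ} (hβ : 2 / 3 < β) {ζ : ℂ} {t : ℝ} (hne : (t : ℂ) ≠ ζ ^ 2) :
    slitKernelReg β ζ t = slitKernel β ζ t := by
  rw [slitKernelReg]
  split_ifs with ht
  · have hc := sqrt_neg_mul_I_sq ht
    have hcim : 0 ≤ ((Real.sqrt (-t) : ℂ) * I).im := by simp
    set c : ℂ := (Real.sqrt (-t) : ℂ) * I
    obtain ⟨C, hC0, hC⟩ := exists_norm_slitNumerator_le hβ
    have h0 : slitNumerator β c t = 0 := by
      have := hC c t hcim
      rw [hc, sub_self, norm_zero, mul_zero, zero_mul, zero_mul] at this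
      exact norm_le_zero_iff.1 this
    have hζc : ζ ≠ c := fun h => hne (by rw [h, hc])
    rw [dslope_of_ne _ hζc, slope_def_field, h0, sub_zero, slitKernel, ← hc, sq_sub_sq,
      div_eq_mul_inv, mul_assoc, ← mul_inv, ← mul_neg, ← inv_neg]
    congr 2
    ring
  · rfl

theorem differentiableOn_slitKernelReg {β : ℝ} (hβ : 2 / 3 < β) (t : ℝ) :
    DifferentiableOn ℂ (fun ζ => slitKernelReg β ζ t) {ζ | 0 < ζ.im} := by
  have hd := differentiableOn_slitNumerator hβ t
  by_cases ht : t < 0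
  · simp only [slitKernelReg, if_pos ht]
    have hpos : 0 < Real.sqrt (-t) := Real.sqrt_pos.2 (by linarith)
    have hc : (Real.sqrt (-t) * I : ℂ) ∈ {ζ : ℂ | 0 < ζ.im} := by simpa using hpos
    refine (((Complex.differentiableOn_dslope (isOpen_upperHalfPlane.mem_nhds hc)).2 hd).mul
      fun ζ (hζ : 0 < ζ.im) => ?_).neg
    have : ζ + Real.sqrt (-t) * I ≠ 0 := fun h => by
      have := congrArg Complex.im h
      simp at this; linarith
    fun_prop (disch := assumption)
  · simp only [slitKernelReg, if_neg ht, slitKernel]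
    refine hd.mul fun ζ (hζ : 0 < ζ.im) => ?_
    have : (t : ℂ) - ζ ^ 2 ≠ 0 := fun h => by
      have h1 := congrArg Complex.im h
      have h2 := congrArg Complex.re h
      simp only [sq, Complex.sub_im, Complex.sub_re, Complex.mul_im, Complex.mul_re,
        Complex.ofReal_re, Complex.ofReal_im, Complex.zero_re, Complex.zero_im] at h1 h2
      have h3 : ζ.re * ζ.im = 0 := by linarith
      rcases mul_eq_zero.1 h3 with h3 | h3
      · rw [h3] at h2; nlinarith
      · linarith
    fun_prop (disch := assumption)

theorem exists_norm_slitKernelReg_le {β : ℝ} (hβ : 2 / 3 < β) :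
    ∃ C : ℝ, 0 ≤ C ∧ ∀ ζ ∈ {ζ : ℂ | 0 < ζ.im}, ∀ t : ℝ,
      ‖slitKernelReg β ζ t‖ ≤ C * (1 + ‖ζ‖ ^ 2) ^ 3 * ‖((t : ℂ) - I)⁻¹‖ := by
  obtain ⟨C, hC0, hC⟩ := exists_norm_slitKernel_le hβ
  refine ⟨C, hC0, fun ζ₀ hζ₀ t => ?_⟩
  have hζ₀' : 0 < ζ₀.im := hζ₀
  have hnhds := isOpen_upperHalfPlane.mem_nhds hζ₀
  -- near `ζ₀` the estimate holds off the point `ζ₀` itself, and both sides are continuous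
  have h1 : Tendsto (fun ζ => ‖slitKernelReg β ζ t‖) (𝓝[≠] ζ₀) (𝓝 ‖slitKernelReg β ζ₀ t‖) :=
    (((differentiableOn_slitKernelReg hβ t).continuousOn.continuousAt hnhds).tendsto.norm).mono_left
      nhdsWithin_le_nhds
  have h2 : Tendsto (fun ζ : ℂ => C * (1 + ‖ζ‖ ^ 2) ^ 3 * ‖((t : ℂ) - I)⁻¹‖) (𝓝[≠] ζ₀)
      (𝓝 (C * (1 + ‖ζ₀‖ ^ 2) ^ 3 * ‖((t : ℂ) - I)⁻¹‖)) := by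
    have : Continuous fun ζ : ℂ => C * (1 + ‖ζ‖ ^ 2) ^ 3 * ‖((t : ℂ) - I)⁻¹‖ := by fun_prop
    exact (this.tendsto ζ₀).mono_left nhdsWithin_le_nhds
  refine le_of_tendsto_of_tendsto h1 h2 ?_
  have hne : ∀ᶠ ζ in 𝓝[≠] ζ₀, (t : ℂ) ≠ ζ ^ 2 := by
    have h3 : ∀ᶠ ζ in 𝓝[≠] ζ₀, ζ + ζ₀ ≠ 0 := by
      refine nhdsWithin_le_nhds ?_
      filter_upwards [hnhds] with ζ (hζ : 0 < ζ.im) h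
      have := congrArg Complex.im h
      simp at this; linarith
    by_cases ht : (t : ℂ) = ζ₀ ^ 2
    · filter_upwards [h3, self_mem_nhdsWithin] with ζ hζ hζ' h
      rw [ht, eq_comm, sq_eq_sq_iff_eq_or_eq_neg] at h
      rcases h with h | h
      · exact hζ' h
      · exact hζ (by rw [h]; ring)
    · refine nhdsWithin_le_nhds ?_
      have : ContinuousAt (fun ζ : ℂ => ζ ^ 2) ζ₀ := by fun_prop
      filter_upwards [this.eventually_ne (Ne.symm ht)] with ζ hζ using hζ.symm
  filter_upwards [hne, nhdsWithin_le_nhds hnhds] with ζ h3 (h4 : 0 < ζ.im)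
  rw [slitKernelReg_eq hβ h3]
  exact hC ζ t h4.le

theorem differentiableOn_slitExtension {β : ℝ} (hβ : 2 / 3 < β)
    (f : Lp ℂ 2 (volume : Measure ℝ)) :
    DifferentiableOn ℂ (slitExtension β f) {ζ | 0 < ζ.im} := by
  obtain ⟨C, hC0, hC⟩ := exists_norm_slitKernelReg_le hβ
  have hae : ∀ ζ : ℂ, (fun t : ℝ => f t * slitKernelReg β ζ t) =ᵐ[volume]
      fun t => f t * slitKernel β ζ t := fun ζ => by
    filter_upwards [ae_ofReal_ne (ζ ^ 2)] with t ht
    rw [slitKernelReg_eq hβ ht]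
  have h : DifferentiableOn ℂ (fun ζ => ∫ t : ℝ, f t * slitKernelReg β ζ t) {ζ | 0 < ζ.im} := by
    refine differentiableOn_integral_of_locally_dominated isOpen_upperHalfPlane (fun ζ _ => ?_)
      (fun t => (differentiableOn_slitKernelReg hβ t).const_mul _) fun ζ₀ hζ₀ =>
        ⟨1, one_pos, _, (integrable_norm_mul_norm_inv_sub_I f).const_mul _, fun t ζ hζ =>
          norm_mul_slitKernel_le hC0 hC f hζ.2 hζ.1 t⟩
    exact ((Lp.aestronglyMeasurable f).mul
      (measurable_slitKernel hβ ζ).aestronglyMeasurable).congr (hae ζ).symm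
  refine (h.const_mul ((2 * Real.pi * I)⁻¹ : ℂ)).congr fun ζ _ => ?_
  rw [slitExtension, integral_congr_ae (hae ζ)]

/-- On the first quadrant the extension is the given Hardy function, up to the factor `E`. -/
theorem slitExtension_eq {β : ℝ} (hβ : 2 / 3 < β) {f : Lp ℂ 2 (volume : Measure ℝ)}
    (hf : f ∈ modelSpace (blaschkeBeta β)) {F : ℂ → ℂ} (hF : IsHardyTwo F)
    (hFf : IsBoundaryFunction F f) {ζ : ℂ} (hre : 0 < ζ.re) (him : 0 < ζ.im) :
    slitExtension β f ζ = reflectedRootProduct β ζ * F (ζ ^ 2) := by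
  have hβ' : 1 / 2 < β := by linarith
  have hw : 0 < (ζ ^ 2).im := by rw [sq, Complex.mul_im]; nlinarith [mul_pos hre him]
  have hk := memLp_inv_ofReal_sub (w := ζ ^ 2) hw.ne'
  have hi1 : Integrable fun t : ℝ => f t * ((t : ℂ) - ζ ^ 2)⁻¹ := (Lp.memLp f).integrable_mul hk
  have hB := continuous_blaschkeBeta_ofReal hβ'
  have hi2 : Integrable fun t : ℝ => f t * conj (blaschkeBeta β t) * ((t : ℂ) - ζ ^ 2)⁻¹ := by
    refine hi1.mono (((Lp.aestronglyMeasurable f).mul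
      (Complex.continuous_conj.comp hB).aestronglyMeasurable).mul hk.1)
      (Eventually.of_forall fun t => ?_)
    simp [norm_blaschkeBeta_ofReal hβ']
  have h1 : ∀ t : ℝ, f t * slitKernel β ζ t =
      reflectedRootProduct β ζ * (f t * ((t : ℂ) - ζ ^ 2)⁻¹) -
        rootProduct β ζ * (f t * conj (blaschkeBeta β t) * ((t : ℂ) - ζ ^ 2)⁻¹) := fun t => by
    rw [slitKernel, slitNumerator]; ring
  rw [slitExtension]
  simp_rw [h1]
  rw [integral_sub (hi1.const_mul _) (hi2.const_mul _), integral_const_mul, integral_const_mul,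
    integral_mul_conj_blaschkeBeta_eq_zero hβ' hf hw, hF.integral_mul_inv_sub hFf hw]
  have : (2 * Real.pi * I : ℂ) ≠ 0 := Complex.two_pi_I_ne_zero
  field_simp
  ring

/-! ### Boundary values on the positive half-line -/

/-- The boundary function is the almost everywhere limit along a sequence of horizontal lines. -/
theorem IsHardyTwo.exists_seq_tendsto_ae {F : ℂ → ℂ} (hF : IsHardyTwo F)
    {f : Lp ℂ 2 (volume : Measure ℝ)} (hFf : IsBoundaryFunction F f) :
    ∃ y : ℕ → ℝ, (∀ n, 0 < y n) ∧ Tendsto y atTop (𝓝 0) ∧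
      ∀ᵐ x : ℝ, Tendsto (fun n => F (x + y n * I)) atTop (𝓝 (f x)) := by
  set y : ℕ → ℝ := fun n => 1 / ((n : ℝ) + 1) with hy
  have hy0 : ∀ n, 0 < y n := fun n => Nat.one_div_pos_of_nat
  have hyt : Tendsto y atTop (𝓝 0) := tendsto_one_div_add_atTop_nhds_zero_nat
  have hy1 : Tendsto y atTop (𝓝[>] 0) :=
    tendsto_nhdsWithin_iff.2 ⟨hyt, Eventually.of_forall hy0⟩
  have hmeas : ∀ n, AEStronglyMeasurable (fun x : ℝ => F (x + y n * I)) volume := fun n =>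
    (hF.1.continuousOn.comp_continuous (by fun_prop) fun x => by
      simpa using hy0 n).aestronglyMeasurable
  have h1 := tendstoInMeasure_of_tendsto_eLpNorm two_ne_zero hmeas (Lp.aestronglyMeasurable f)
    (hFf.comp hy1)
  obtain ⟨ns, hns, hae⟩ := h1.exists_seq_tendsto_ae
  exact ⟨y ∘ ns, fun n => hy0 _, hyt.comp hns.tendsto_atTop, hae⟩

theorem norm_slitExtension_sqrt {β : ℝ} (hβ : 2 / 3 < β) {f : Lp ℂ 2 (volume : Measure ℝ)}
    (hf : f ∈ modelSpace (blaschkeBeta β)) :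
    ∀ᵐ x : ℝ, 0 < x → ‖slitExtension β f (Real.sqrt x)‖ = ‖f x‖ := by
  obtain ⟨F, hF, hFf⟩ := hf.1
  obtain ⟨y, hy0, hyt, hae⟩ := hF.exists_seq_tendsto_ae hFf
  filter_upwards [hae] with x hx hx0
  have hs0 : 0 < Real.sqrt x := Real.sqrt_pos.2 hx0
  choose ζ hζ using fun n => exists_sq_eq_of_im_pos (z := x + y n * I) (by simpa using hy0 n)
  have hζlim : Tendsto ζ atTop (𝓝[{ζ : ℂ | 0 ≤ ζ.im}] (Real.sqrt x : ℂ)) := by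
    refine tendsto_nhdsWithin_iff.2 ⟨?_, Eventually.of_forall fun n => (hζ n).2.2.le⟩
    rw [tendsto_iff_norm_sub_tendsto_zero]
    have h1 : ∀ n, ‖ζ n - Real.sqrt x‖ ≤ y n / Real.sqrt x := fun n => by
      have h2 : (ζ n - Real.sqrt x) * (ζ n + Real.sqrt x) = y n * I := by
        have h3 : ((Real.sqrt x : ℝ) : ℂ) ^ 2 = x := by
          rw [← Complex.ofReal_pow, Real.sq_sqrt hx0.le]
        linear_combination (hζ n).1 - h3
      have h3 : Real.sqrt x ≤ ‖ζ n + Real.sqrt x‖ := by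
        have := (le_abs_self _).trans (Complex.abs_re_le_norm (ζ n + Real.sqrt x))
        simp only [Complex.add_re, Complex.ofReal_re] at this
        linarith [(hζ n).2.1]
      rw [le_div_iff₀ hs0]
      calc ‖ζ n - Real.sqrt x‖ * Real.sqrt x ≤ ‖ζ n - Real.sqrt x‖ * ‖ζ n + Real.sqrt x‖ := by
            gcongr
        _ = y n := by
            rw [← norm_mul, h2, norm_mul, Complex.norm_I, mul_one, Complex.norm_real,
              Real.norm_eq_abs, abs_of_pos (hy0 n)]
    refine squeeze_zero (fun n => norm_nonneg _) h1 ?_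
    simpa using hyt.div_const (Real.sqrt x)
  have hE : ContinuousOn (reflectedRootProduct β) {ζ | 0 ≤ ζ.im} :=
    (isBlaschkeSeq_sqrtZero hβ).neg_conj.continuousOn_blaschkeProduct
  have hE1 : ‖reflectedRootProduct β (Real.sqrt x)‖ = 1 :=
    (isBlaschkeSeq_sqrtZero hβ).neg_conj.norm_blaschkeProduct_ofReal _
  have hmem : ((Real.sqrt x : ℝ) : ℂ) ∈ {ζ : ℂ | 0 ≤ ζ.im} := by simp
  have hl1 := (continuousOn_slitExtension hβ f _ hmem).tendsto.comp hζlim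
  have hl2 := ((hE _ hmem).tendsto.comp hζlim).mul hx
  have heq := tendsto_nhds_unique (hl1.congr fun n => by
    rw [Function.comp_apply, slitExtension_eq hβ hf hF hFf (hζ n).2.1 (hζ n).2.2, (hζ n).1]
    rfl) hl2
  rw [heq, norm_mul, hE1, one_mul]

theorem exists_slitExtension_ne_zero {β : ℝ} (hβ : 2 / 3 < β) {f : Lp ℂ 2 (volume : Measure ℝ)}
    (hf : f ∈ modelSpace (blaschkeBeta β)) (hf0 : f ≠ 0) :
    ∃ ζ : ℂ, 0 < ζ.im ∧ slitExtension β f ζ ≠ 0 := by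
  by_contra! hG
  obtain ⟨F, hF, hFf⟩ := hf.1
  -- `E` is unimodular at the boundary point `1`, hence has no zeros near it
  have hE : ContinuousWithinAt (reflectedRootProduct β) {ζ | 0 ≤ ζ.im} (1 : ℝ) :=
    (isBlaschkeSeq_sqrtZero hβ).neg_conj.continuousOn_blaschkeProduct _ (by simp)
  have hE1 : reflectedRootProduct β (1 : ℝ) ≠ 0 := by
    have h1 : ‖reflectedRootProduct β (1 : ℝ)‖ = 1 :=
      (isBlaschkeSeq_sqrtZero hβ).neg_conj.norm_blaschkeProduct_ofReal 1
    exact norm_ne_zero_iff.1 (by rw [h1]; exact one_ne_zero)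
  obtain ⟨ε, hε, hball⟩ := Metric.mem_nhdsWithin_iff.1 (hE.eventually_ne hE1)
  set q : Set ℂ := {ζ | 0 < ζ.re} ∩ {ζ | 0 < ζ.im} with hq
  have hqo : IsOpen q :=
    (isOpen_lt continuous_const Complex.continuous_re).inter isOpen_upperHalfPlane
  have hqc : Convex ℝ q := (convex_halfSpace_re_gt 0).inter (convex_halfSpace_im_gt 0)
  have han : AnalyticOnNhd ℂ (fun ζ => F (ζ ^ 2)) q := by
    refine DifferentiableOn.analyticOnNhd ?_ hqo
    refine hF.1.comp (by fun_prop) fun ζ hζ => ?_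
    have h1 : 0 < ζ.re := hζ.1
    have h2 : 0 < ζ.im := hζ.2
    show 0 < (ζ ^ 2).im
    rw [sq, Complex.mul_im]
    positivity
  set ζ₁ : ℂ := (1 : ℝ) + (ε / 2 : ℝ) * I with hζ₁
  have hζ₁q : ζ₁ ∈ q := by
    constructor
    · simp [hζ₁]
    · simp [hζ₁, hε]
  have hζ₁b : ζ₁ ∈ Metric.ball (((1 : ℝ) : ℂ)) ε := by
    rw [mem_ball_iff_norm, hζ₁, add_sub_cancel_left, norm_mul, Complex.norm_I, mul_one,
      Complex.norm_real, Real.norm_eq_abs, abs_of_pos (by linarith)]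
    linarith
  have hev : (fun ζ => F (ζ ^ 2)) =ᶠ[𝓝 ζ₁] 0 := by
    filter_upwards [hqo.mem_nhds hζ₁q, Metric.isOpen_ball.mem_nhds hζ₁b] with ζ h1 h2
    have h3 : reflectedRootProduct β ζ ≠ 0 := hball ⟨h2, le_of_lt (show 0 < ζ.im from h1.2)⟩
    have h4 := slitExtension_eq hβ hf hF hFf h1.1 h1.2
    rw [hG ζ h1.2] at h4
    exact (mul_eq_zero.1 h4.symm).resolve_left h3
  have hF0 : ∀ w : ℂ, 0 < w.im → F w = 0 := fun w hw => by
    obtain ⟨ζ, h1, h2, h3⟩ := exists_sq_eq_of_im_pos hw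
    rw [← h1]
    exact han.eqOn_zero_of_preconnected_of_eventuallyEq_zero hqc.isPreconnected hζ₁q hev ⟨h2, h3⟩
  obtain ⟨y, hy0, -, hae⟩ := hF.exists_seq_tendsto_ae hFf
  refine hf0 ((Lp.eq_zero_iff_ae_eq_zero).2 ?_)
  filter_upwards [hae] with x hx
  refine tendsto_nhds_unique hx (tendsto_const_nhds.congr fun n => ?_)
  exact (hF0 _ (by simpa using hy0 n)).symm

/-! ### Comparison of the weights -/

theorem rpow_three_halves {x : ℝ} (hx : 0 ≤ x) : x ^ (3 / 2 : ℝ) = Real.sqrt x ^ 3 := by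
  rw [Real.sqrt_eq_rpow, ← Real.rpow_natCast, ← Real.rpow_mul hx]; norm_num

theorem one_add_rpow_le {x : ℝ} (hx : 0 ≤ x) :
    (1 + x) ^ (3 / 2 : ℝ) ≤ 2 * (x ^ (3 / 2 : ℝ) + 1) := by
  rw [rpow_three_halves hx, rpow_three_halves (by positivity)]
  set u := Real.sqrt x
  have hu : 0 ≤ u := Real.sqrt_nonneg x
  have hx2 : u ^ 2 = x := Real.sq_sqrt hx
  have h1 : Real.sqrt (1 + x) ≤ 1 + u := by
    rw [Real.sqrt_le_left (by positivity)]; nlinarith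
  have h2 : Real.sqrt (1 + x) ^ 2 = 1 + u ^ 2 := by rw [Real.sq_sqrt (by positivity), hx2]
  calc Real.sqrt (1 + x) ^ 3 = Real.sqrt (1 + x) * (1 + u ^ 2) := by rw [← h2]; ring
    _ ≤ (1 + u) * (1 + u ^ 2) := by gcongr
    _ ≤ 2 * (u ^ 3 + 1) := by nlinarith [mul_nonneg (sq_nonneg (u - 1)) (by positivity : 0 ≤ u + 1)]

theorem sqrt_mul_one_add_le {x : ℝ} (hx : 0 ≤ x) :
    Real.sqrt x * (1 + x) ≤ 2 * (x ^ (3 / 2 : ℝ) + 1) := by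
  refine le_trans ?_ (one_add_rpow_le hx)
  have h1 : Real.sqrt (1 + x) ^ 2 = 1 + x := Real.sq_sqrt (by positivity)
  rw [rpow_three_halves (by positivity), pow_succ, h1, mul_comm]
  gcongr
  linarith

theorem integrableOn_one_add_log_div :
    IntegrableOn (fun x : ℝ => (1 + Real.log (1 + x)) / (x ^ (3 / 2 : ℝ) + 1)) (Set.Ioi 0) := by
  have h1 : Integrable fun x : ℝ => (1 + ‖x‖) ^ (-(5 / 4) : ℝ) :=
    integrable_one_add_norm (by simp; norm_num)
  refine Integrable.mono' ((h1.const_mul 10).integrableOn) ?_ ?_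
  · exact Measurable.aestronglyMeasurable (by fun_prop)
  · refine (ae_restrict_iff' measurableSet_Ioi).2 (Eventually.of_forall fun x (hx : 0 < x) => ?_)
    have h2 : 0 ≤ Real.log (1 + x) := Real.log_nonneg (by linarith)
    have h3 : Real.log (1 + x) ≤ (1 + x) ^ (1 / 4 : ℝ) / (1 / 4) :=
      Real.log_le_rpow_div (by linarith) (by norm_num)
    have h4 : 1 ≤ (1 + x) ^ (1 / 4 : ℝ) := Real.one_le_rpow (by linarith) (by norm_num)
    have h5 := one_add_rpow_le hx.le
    have h6 : 0 < (1 + x) ^ (3 / 2 : ℝ) := by positivity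
    rw [Real.norm_of_nonneg (by positivity), Real.norm_of_nonneg hx.le,
      div_le_iff₀ (by positivity)]
    have h7 : (1 + x) ^ (1 / 4 : ℝ) = (1 + x) ^ (-(5 / 4) : ℝ) * (1 + x) ^ (3 / 2 : ℝ) := by
      rw [← Real.rpow_add (by positivity)]; norm_num
    have h8 : 0 < (1 + x) ^ (-(5 / 4) : ℝ) := by positivity
    nlinarith [mul_le_mul_of_nonneg_left h5 h8.le]

end

theorem theorem3p1 (β : ℝ) (hβ : 2 / 3 < β) (f : Lp ℂ 2 (volume : Measure ℝ))
    (hf : f ∈ modelSpace (blaschkeBeta β)) (hf0 : f ≠ 0) :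
    (∀ᵐ t : ℝ ∂(volume.restrict (Set.Ioi (0 : ℝ))), f t ≠ 0) ∧
      IntegrableOn (fun t : ℝ => Real.log ‖f t‖ / (t ^ (3 / 2 : ℝ) + 1))
        (Set.Ioi (0 : ℝ)) volume := by
  obtain ⟨C₁, hC₁⟩ := exists_norm_slitExtension_le hβ f
  set C : ℝ := max C₁ 1 with hC
  have hC0 : 0 < C := lt_max_of_lt_right one_pos
  have hζI : ∀ ζ : ℂ, 0 ≤ ζ.im → ζ + I ≠ 0 := fun ζ hζ h => by
    have := congrArg Complex.im h; simp at this; linarith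
  have hnorm : ∀ ζ : ℂ, 0 ≤ ζ.im → 1 + ‖ζ‖ ^ 2 ≤ ‖ζ + I‖ ^ 2 := fun ζ hζ => by
    rw [Complex.sq_norm, Complex.sq_norm, Complex.normSq_apply, Complex.normSq_apply]
    simp
    nlinarith
  -- the normalization makes the extension bounded by `1`
  set G : ℂ → ℂ := fun ζ => slitExtension β f ζ / (C * (ζ + I) ^ 6) with hG
  have hden : ∀ ζ : ℂ, 0 ≤ ζ.im → (C * (ζ + I) ^ 6 : ℂ) ≠ 0 := fun ζ hζ =>
    mul_ne_zero (by exact_mod_cast hC0.ne') (pow_ne_zero _ (hζI ζ hζ))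
  have hden' : ∀ ζ : ℂ, ‖(C * (ζ + I) ^ 6 : ℂ)‖ = C * (‖ζ + I‖ ^ 2) ^ 3 := fun ζ => by
    rw [norm_mul, norm_pow, Complex.norm_real, Real.norm_of_nonneg hC0.le, ← pow_mul]
  have hGb : ∀ ζ : ℂ, 0 ≤ ζ.im → ‖G ζ‖ ≤ 1 := fun ζ hζ => by
    rw [hG, norm_div, div_le_one (norm_pos_iff.2 (hden ζ hζ)), hden']
    refine (hC₁ ζ hζ).trans ?_
    gcongr
    · exact le_max_left _ _
    · exact hnorm ζ hζ
  have hint := lintegral_negLog_sqrt_ne_top (G := G)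
    ((differentiableOn_slitExtension hβ f).div (by fun_prop) fun ζ hζ => hden ζ (le_of_lt hζ))
    ((continuousOn_slitExtension hβ f).div (by fun_prop) hden) (fun ζ hζ => hGb ζ hζ.le) (by
      obtain ⟨ζ, h1, h2⟩ := exists_slitExtension_ne_zero hβ hf hf0
      exact ⟨ζ, h1, div_ne_zero h2 (hden ζ h1.le)⟩)
  have hGc : Continuous fun t : ℝ => ‖G (Real.sqrt t)‖ :=
    (((continuousOn_slitExtension hβ f).div (by fun_prop) hden).comp_continuous
      (by fun_prop) fun t => by simp).norm
  have hmeas : Measurable fun t : ℝ => ENNReal.ofReal (1 / (Real.sqrt t * (1 + t))) *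
      negLog ‖G (Real.sqrt t)‖ :=
    Measurable.mul (by fun_prop) (continuous_negLog.comp hGc).measurable
  have hGf : ∀ᵐ t : ℝ ∂(volume.restrict (Set.Ioi (0 : ℝ))),
      ‖f t‖ = ‖G (Real.sqrt t)‖ * (C * (1 + t) ^ 3) := by
    refine (ae_restrict_iff' measurableSet_Ioi).2 ?_
    filter_upwards [norm_slitExtension_sqrt hβ hf] with t ht ht0
    have h1 : ‖((Real.sqrt t : ℝ) : ℂ) + I‖ ^ 2 = 1 + t := by
      rw [Complex.sq_norm, Complex.normSq_apply]
      simp [Real.mul_self_sqrt (le_of_lt ht0), add_comm]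
    have ht0' : 0 < t := ht0
    rw [← ht ht0, hG, norm_div, hden', h1, div_mul_cancel₀ _ (by positivity)]
  have hfin : ∀ᵐ t : ℝ ∂(volume.restrict (Set.Ioi (0 : ℝ))), G (Real.sqrt t) ≠ 0 := by
    filter_upwards [ae_lt_top hmeas hint, ae_restrict_mem measurableSet_Ioi] with t ht ht0 h0
    have ht0' : 0 < t := ht0
    have h1 : ENNReal.ofReal (1 / (Real.sqrt t * (1 + t))) ≠ 0 :=
      (ENNReal.ofReal_pos.2 (by positivity)).ne'
    rw [h0, norm_zero, negLog, if_pos rfl, ENNReal.mul_top h1] at ht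
    exact lt_irrefl _ ht
  refine ⟨?_, ?_⟩
  · filter_upwards [hGf, hfin, ae_restrict_mem measurableSet_Ioi] with t h1 h2 ht0
    have ht0' : 0 < t := ht0
    rw [← norm_ne_zero_iff, h1]
    exact mul_ne_zero (norm_ne_zero_iff.2 h2) (by positivity)
  · have hi1 := integrable_toReal_of_lintegral_ne_top hmeas.aemeasurable hint
    have hi2 := integrableOn_one_add_log_div.const_mul (|Real.log C| + 3)
    refine Integrable.mono' ((hi1.const_mul 2).add hi2) ?_ ?_
    · have h1 : AEStronglyMeasurable (fun t => ‖f t‖) (volume.restrict (Set.Ioi (0 : ℝ))) :=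
        (Lp.aestronglyMeasurable f).norm.restrict
      have h2 : Measurable fun t : ℝ => t ^ (3 / 2 : ℝ) + 1 := by fun_prop
      exact ((Real.measurable_log.comp_aemeasurable h1.aemeasurable).div
        h2.aemeasurable).aestronglyMeasurable
    · filter_upwards [hGf, hfin, ae_restrict_mem measurableSet_Ioi] with t h1 h2 ht0
      have ht0' : 0 < t := ht0
      have hg0 : ‖G (Real.sqrt t)‖ ≠ 0 := norm_ne_zero_iff.2 h2
      have hL : 0 ≤ -Real.log ‖G (Real.sqrt t)‖ :=
        neg_nonneg.2 (Real.log_nonpos (norm_nonneg _) (hGb _ (by simp)))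
      have hl : 0 ≤ Real.log (1 + t) := Real.log_nonneg (by linarith)
      have hw : 0 < t ^ (3 / 2 : ℝ) + 1 := by positivity
      have hs : 0 < Real.sqrt t * (1 + t) := by positivity
      have hlog : Real.log ‖f t‖ =
          Real.log ‖G (Real.sqrt t)‖ + (Real.log C + 3 * Real.log (1 + t)) := by
        rw [h1, Real.log_mul hg0 (by positivity), Real.log_mul hC0.ne' (by positivity),
          Real.log_pow]
        push_cast; ring
      have habs : |Real.log ‖f t‖| ≤ -Real.log ‖G (Real.sqrt t)‖ +
          (|Real.log C| + 3) * (1 + Real.log (1 + t)) := by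
        rw [hlog]
        have h3 := abs_nonneg (Real.log C)
        have h4 := le_abs_self (Real.log C)
        have h5 := neg_abs_le (Real.log C)
        rw [abs_le]
        constructor <;> nlinarith [mul_nonneg h3 hl]
      have hto : (ENNReal.ofReal (1 / (Real.sqrt t * (1 + t))) *
          negLog ‖G (Real.sqrt t)‖).toReal =
          1 / (Real.sqrt t * (1 + t)) * -Real.log ‖G (Real.sqrt t)‖ := by
        rw [negLog, if_neg hg0, ENNReal.toReal_mul, ENNReal.toReal_ofReal (by positivity),
          ENNReal.toReal_ofReal hL]
      simp only [Pi.add_apply]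
      rw [hto, norm_div, Real.norm_eq_abs, Real.norm_of_nonneg hw.le]
      have hwt : 1 / (t ^ (3 / 2 : ℝ) + 1) ≤ 2 * (1 / (Real.sqrt t * (1 + t))) := by
        rw [mul_one_div, div_le_div_iff₀ hw hs]
        linarith [sqrt_mul_one_add_le ht0'.le]
      calc |Real.log ‖f t‖| / (t ^ (3 / 2 : ℝ) + 1)
          ≤ (-Real.log ‖G (Real.sqrt t)‖ + (|Real.log C| + 3) * (1 + Real.log (1 + t))) /
            (t ^ (3 / 2 : ℝ) + 1) := by gcongr
        _ = 1 / (t ^ (3 / 2 : ℝ) + 1) * -Real.log ‖G (Real.sqrt t)‖ +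
            (|Real.log C| + 3) * ((1 + Real.log (1 + t)) / (t ^ (3 / 2 : ℝ) + 1)) := by ring
        _ ≤ 2 * (1 / (Real.sqrt t * (1 + t))) * -Real.log ‖G (Real.sqrt t)‖ +
            (|Real.log C| + 3) * ((1 + Real.log (1 + t)) / (t ^ (3 / 2 : ℝ) + 1)) := by
            gcongr
        _ = _ := by ring
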